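/- Let $S^n$ denote the unit sphere with its angular metric ($S^{-1}=\emptyset$). Let $B$ be a (complete) spherical building of dimension $n\ge 0$ with its CAT(1) metric, not necessarily thick or irreducible: that is, a complete CAT(1) space together with a finite group $W$ of isometries of $S^n$ generated by reflections in hyperplanes and a collection of isometric embeddings $\iota:S^n\to B$ (charts), closed under precomposition with elements of $W$, such that any two points of $B$ lie in the image of a common chart, and such that for any two charts $\iota_1,\iota_2$ the map $\iota_1^{-1}\circ\iota_2$, where defined, is the restriction of an element of $W$. The apartments of $B$ are the images of the charts. For $x\in B$ let $\Sigma_xB$ be the space of directions at $x$ (geodesics starting at $x$, identified if their angle is zero, with the angle as metric); it is an $(n-1)$-dimensional spherical building, whose apartments (for the maximal system of apartments) are the subsets isometric to $S^{n-1}$. For a subset $C\subset B$ containing $x$, let $\Sigma_xC\subset\Sigma_xB$ be the set of directions of geodesics that start at $x$ and run in $C$. Let $C\subset B$ be a closed subset that is convex (for any $y,z\in C$ with $d(y,z)<\pi$, the set $C$ contains the unique geodesic of $B$ between $y$ and $z$) and spherical (isometric to a subset of a unit sphere $S^k$ of some dimension $k$). Let $x\in C$, and let $A_x$ be an apartment of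 $\Sigma_xB$ with $\Sigma_xC\subset A_x$. Then there exists an apartment $A$ of $B$ such that $C\subset A$ and $\Sigma_xA=A_x$. -/

import Mathlib

open Filter Topology Metric

noncomputable section

namespace SphBuild

/-! ### Euclidean space and the round unit sphere -/

/-- Euclidean space of dimension `d`. -/
abbrev E (d : ℕ) : Type := EuclideanSpace ℝ (Fin d)

/-- The unit sphere of `E d`, a sphere of dimension `d - 1` (the empty set for `d = 0`).
Its intrinsic (round) metric is the angular one, so below the distance of `u` and `v` is always
written `InnerProductGeometry.angle u v`. -/
abbrev USphere (d : ℕ) : Type := sphere (0 : E d) 1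

/-- The round distance of two points of the unit sphere. -/
def angDist {d : ℕ} (u v : USphere d) : ℝ := InnerProductGeometry.angle (u : E d) (v : E d)

/-- A distance preserving map from the unit sphere with its round metric. -/
def IsSphereEmbedding {M : Type*} [PseudoMetricSpace M] {d : ℕ} (f : USphere d → M) : Prop :=
  ∀ u v, dist (f u) (f v) = angDist u v

/-- `A` is isometric to the round unit sphere of `E d`. -/
def IsRoundSphere {M : Type*} [PseudoMetricSpace M] (d : ℕ) (A : Set M) : Prop :=
  ∃ f : USphere d → M, IsSphereEmbedding f ∧ Set.range f = A

/-- `C` is isometric to a subset of a round unit sphere of some dimension `k`. -/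
def IsSpherical {M : Type*} [PseudoMetricSpace M] (C : Set M) : Prop :=
  ∃ (k : ℕ) (f : C → USphere (k + 1)), ∀ a b : C, angDist (f a) (f b) = dist a b

/-- The action of a linear isometry on the unit sphere. -/
def sphereMap {d : ℕ} (w : E d ≃ₗᵢ[ℝ] E d) (u : USphere d) : USphere d :=
  ⟨w u, by simp⟩

/-! ### Geodesics, convexity, CAT(1) spaces -/

/-- `z` lies between `a` and `b`, that is (in a space in which points at distance less than `π`
are joined by geodesics, and for `a`, `b` at distance less than `π`) on a geodesic
from `a` to `b`. -/
def Between {M : Type*} [PseudoMetricSpace M] (a z b : M) : Prop :=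
  dist a z + dist z b = dist a b

/-- A subset is convex if it contains the geodesic between any two of its points that are at
distance less than `π`. -/
def IsConvex {M : Type*} [PseudoMetricSpace M] (C : Set M) : Prop :=
  ∀ a ∈ C, ∀ b ∈ C, dist a b < Real.pi → ∀ z, Between a z b → z ∈ C

/-- CAT(1) spaces: points at distance less than `π` are joined by a geodesic, and geodesic
triangles of perimeter less than `2π` are not thicker than their comparison triangles in the
unit sphere of dimension two. Here `a` and `b` are points on the sides `pq` and `pr`. -/
structure IsCAT1 (M : Type*) [PseudoMetricSpace M] : Prop where
  exists_geodesic : ∀ p q : M, dist p q < Real.pi →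
    ∃ c : ℝ → M, c 0 = p ∧ c (dist p q) = q ∧
      ∀ s ∈ Set.Icc 0 (dist p q), ∀ t ∈ Set.Icc 0 (dist p q), dist (c s) (c t) = |s - t|
  comparison : ∀ p q r a b : M, dist p q + dist q r + dist r p < 2 * Real.pi →
    Between p a q → Between p b r →
    ∀ p' q' r' a' b' : USphere 3,
      angDist p' q' = dist p q → angDist q' r' = dist q r → angDist r' p' = dist r p →
      angDist p' a' = dist p a → angDist a' q' = dist a q →
      angDist p' b' = dist p b → angDist b' r' = dist b r →
      dist a b ≤ angDist a' b'

/-! ### Spherical buildings -/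

/-- A finite group of isometries of the unit sphere of `E d` that is generated by reflections in
hyperplanes, in other words the Weyl group of a spherical Coxeter complex on that sphere. -/
def IsFiniteReflectionGroup {d : ℕ} (W : Subgroup (E d ≃ₗᵢ[ℝ] E d)) : Prop :=
  Finite W ∧ ∃ R : Set (E d ≃ₗᵢ[ℝ] E d),
    (∀ r ∈ R, ∃ v : E d, v ≠ 0 ∧ r = (Submodule.span ℝ {v})ᗮ.reflection) ∧
    W = Subgroup.closure R

/-- The structure of an `n`-dimensional spherical building on a metric space `B`: it is a
CAT(1) space with an atlas of isometric embeddings (charts) of the round sphere `Sⁿ`, closed under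
precomposition with the Weyl group `W` of a spherical Coxeter complex on `Sⁿ`, such that any two
points lie in the image of a common chart, and such that the transition map of any two charts is
the restriction of an element of `W`. Thickness and irreducibility are not required. -/
structure SphericalBuilding (n : ℕ) (B : Type*) [MetricSpace B] where
  W : Subgroup (E (n + 1) ≃ₗᵢ[ℝ] E (n + 1))
  isReflectionGroup : IsFiniteReflectionGroup W
  charts : Set (USphere (n + 1) → B)
  cat1 : IsCAT1 B
  isometric : ∀ ι ∈ charts, IsSphereEmbedding ι
  comp_mem : ∀ ι ∈ charts, ∀ w ∈ W, ι ∘ sphereMap w ∈ charts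
  plenty : ∀ a b : B, ∃ ι ∈ charts, a ∈ Set.range ι ∧ b ∈ Set.range ι
  compatible : ∀ ι₁ ∈ charts, ∀ ι₂ ∈ charts, ∃ w ∈ W,
    ∀ u v, ι₁ u = ι₂ v → u = sphereMap w v

/-- Apartments are the images of the charts. -/
def SphericalBuilding.IsApartment {n : ℕ} {B : Type*} [MetricSpace B]
    (X : SphericalBuilding n B) (A : Set B) : Prop :=
  ∃ ι ∈ X.charts, Set.range ι = A

/-! ### Angles and the space of directions -/

/-- The Euclidean comparison angle at `p`. -/
def compAngle {M : Type*} [PseudoMetricSpace M] (p a b : M) : ℝ :=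
  Real.arccos ((dist p a ^ 2 + dist p b ^ 2 - dist a b ^ 2) / (2 * dist p a * dist p b))

/-- A unit speed geodesic segment of positive length that starts at `x`
(only the values on `[0, length]` matter). -/
structure GeodesicFrom {M : Type*} [PseudoMetricSpace M] (x : M) where
  length : ℝ
  length_pos : 0 < length
  toFun : ℝ → M
  map_zero : toFun 0 = x
  isometric : ∀ s ∈ Set.Icc 0 length, ∀ t ∈ Set.Icc 0 length, dist (toFun s) (toFun t) = |s - t|

/-- The (upper, Alexandrov) angle between two geodesics with the same starting point. -/
def gAngle {M : Type*} [PseudoMetricSpace M] {x : M} (c c' : GeodesicFrom x) : ℝ :=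
  limsup (fun p : ℝ × ℝ => compAngle x (c.toFun p.1) (c'.toFun p.2)) (𝓝[>] 0 ×ˢ 𝓝[>] 0)

section angle

variable {M : Type*} [PseudoMetricSpace M] {x : M}

theorem compAngle_nonneg (p a b : M) : 0 ≤ compAngle p a b := Real.arccos_nonneg _

theorem compAngle_le_pi (p a b : M) : compAngle p a b ≤ Real.pi := Real.arccos_le_pi _

theorem compAngle_comm (p a b : M) : compAngle p a b = compAngle p b a := by
  unfold compAngle
  rw [dist_comm a b]
  congr 1
  ring

theorem compAngle_bdd (f : ℝ × ℝ → M × M) (l : Filter (ℝ × ℝ)) :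
    IsBoundedUnder (· ≤ ·) l (fun p => compAngle x (f p).1 (f p).2) :=
  isBoundedUnder_of ⟨Real.pi, fun _ => compAngle_le_pi _ _ _⟩

theorem compAngle_cobdd (f : ℝ × ℝ → M × M) (l : Filter (ℝ × ℝ)) [l.NeBot] :
    IsCoboundedUnder (· ≤ ·) l (fun p => compAngle x (f p).1 (f p).2) :=
  (isBoundedUnder_of ⟨0, fun _ => compAngle_nonneg _ _ _⟩ :
    IsBoundedUnder (· ≥ ·) l _).isCoboundedUnder_le

theorem dist_start (c : GeodesicFrom x) {t : ℝ} (h0 : 0 ≤ t) (ht : t ≤ c.length) :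
    dist x (c.toFun t) = t := by
  have h := c.isometric 0 ⟨le_rfl, c.length_pos.le⟩ t ⟨h0, ht⟩
  rw [c.map_zero] at h
  rw [h, zero_sub, abs_neg, abs_of_nonneg h0]

theorem gAngle_nonneg (c c' : GeodesicFrom x) : 0 ≤ gAngle c c' :=
  le_limsup_of_frequently_le (Eventually.frequently (Eventually.of_forall
    fun _ => compAngle_nonneg _ _ _)) (compAngle_bdd (fun p => (c.toFun p.1, c'.toFun p.2)) _)

theorem gAngle_self (c : GeodesicFrom x) : gAngle c c = 0 := by
  have hev : ∀ᶠ t in 𝓝[>] (0 : ℝ), 0 < t ∧ t ≤ c.length := by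
    filter_upwards [Ioc_mem_nhdsGT c.length_pos] with t ht using ht
  have h : (fun p : ℝ × ℝ => compAngle x (c.toFun p.1) (c.toFun p.2))
      =ᶠ[𝓝[>] 0 ×ˢ 𝓝[>] 0] fun _ => 0 := by
    filter_upwards [hev.prod_mk hev] with p hp
    obtain ⟨⟨h1, h2⟩, h3, h4⟩ := hp
    unfold compAngle
    rw [dist_start c h1.le h2, dist_start c h3.le h4,
      c.isometric _ ⟨h1.le, h2⟩ _ ⟨h3.le, h4⟩, sq_abs]
    rw [show p.1 ^ 2 + p.2 ^ 2 - (p.1 - p.2) ^ 2 = 2 * p.1 * p.2 by ring,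
      div_self (by positivity), Real.arccos_one]
  unfold gAngle
  rw [limsup_congr h, limsup_const]

theorem gAngle_comm (c c' : GeodesicFrom x) : gAngle c c' = gAngle c' c := by
  have h : (fun p : ℝ × ℝ => compAngle x (c.toFun p.1) (c'.toFun p.2))
      = (fun p : ℝ × ℝ => compAngle x (c'.toFun p.1) (c.toFun p.2)) ∘ Prod.swap := by
    funext p
    exact compAngle_comm _ _ _
  unfold gAngle
  rw [h, limsup, ← map_map, ← prod_comm, limsup]

/-- The law of cosines. -/
def cosSide (s t α : ℝ) : ℝ := Real.sqrt (s ^ 2 + t ^ 2 - 2 * s * t * Real.cos α)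

theorem exists_point_on_side {a b α β : ℝ} (ha : 0 < a) (hb : 0 < b) (hα : 0 < α) (hβ : 0 < β)
    (h : α + β < Real.pi) :
    ∃ t, 0 < t ∧ t ≤ max a b ∧ cosSide a t α + cosSide t b β = cosSide a b (α + β) := by
  have s1 : 0 < Real.sin α := Real.sin_pos_of_pos_of_lt_pi hα (by linarith)
  have s2 : 0 < Real.sin β := Real.sin_pos_of_pos_of_lt_pi hβ (by linarith)
  have s3 : 0 < Real.sin (α + β) := Real.sin_pos_of_pos_of_lt_pi (by linarith) h
  have hD : 0 < a * Real.sin α + b * Real.sin β := by positivity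
  set D := a * Real.sin α + b * Real.sin β with hDdef
  have e1 := Real.sin_sq_add_cos_sq α
  have e2 := Real.sin_sq_add_cos_sq β
  obtain ⟨l, hl⟩ : ∃ l, l = b * Real.sin β / D := ⟨_, rfl⟩
  obtain ⟨m, hm⟩ : ∃ m, m = a * Real.sin α / D := ⟨_, rfl⟩
  have hl0 : 0 ≤ l := by rw [hl]; positivity
  have hm0 : 0 ≤ m := by rw [hm]; positivity
  have hlm : l + m = 1 := by
    rw [hl, hm, ← add_div, add_comm, ← hDdef, div_self hD.ne']
  have hbal : l * (a * Real.sin α) = m * (b * Real.sin β) := by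
    rw [hl, hm]; ring
  have ht : a * b * Real.sin (α + β) / D = l * (a * Real.cos α) + m * (b * Real.cos β) := by
    rw [hl, hm, Real.sin_add]; ring
  have hl1 : l = 1 - m := by linarith
  set L := a ^ 2 + b ^ 2 - 2 * a * b * Real.cos (α + β) with hL
  have hL' : L = (a * Real.cos α - b * Real.cos β) ^ 2
      + (a * Real.sin α + b * Real.sin β) ^ 2 := by
    rw [hL, Real.cos_add]
    linear_combination (-a ^ 2) * e1 + (-b ^ 2) * e2
  have hL0 : 0 ≤ L := by rw [hL']; positivity
  refine ⟨a * b * Real.sin (α + β) / D, by positivity, ?_, ?_⟩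
  · rw [ht]
    have c1 : a * Real.cos α ≤ max a b :=
      (mul_le_of_le_one_right ha.le (Real.cos_le_one _)).trans (le_max_left _ _)
    have c2 : b * Real.cos β ≤ max a b :=
      (mul_le_of_le_one_right hb.le (Real.cos_le_one _)).trans (le_max_right _ _)
    calc l * (a * Real.cos α) + m * (b * Real.cos β) ≤ l * max a b + m * max a b := by gcongr
      _ = max a b := by rw [← add_mul, hlm, one_mul]
  · rw [ht]
    set t := l * (a * Real.cos α) + m * (b * Real.cos β) with htd
    have k1 : a ^ 2 + t ^ 2 - 2 * a * t * Real.cos α = m ^ 2 * L := by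
      have x1 : a * Real.cos α - t = m * (a * Real.cos α - b * Real.cos β) := by
        rw [htd, hl1]; ring
      have x2 : a * Real.sin α = m * (a * Real.sin α + b * Real.sin β) := by
        rw [mul_add, ← hbal, hl1]; ring
      have : a ^ 2 + t ^ 2 - 2 * a * t * Real.cos α
          = (a * Real.cos α - t) ^ 2 + (a * Real.sin α) ^ 2 := by
        linear_combination (-a ^ 2) * e1
      rw [this, x1, hL']
      linear_combination
        (a * Real.sin α + m * (a * Real.sin α + b * Real.sin β)) * x2
    have k2 : t ^ 2 + b ^ 2 - 2 * t * b * Real.cos β = l ^ 2 * L := by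
      have x1 : b * Real.cos β - t = l * (b * Real.cos β - a * Real.cos α) := by
        rw [htd]; have : m = 1 - l := by linarith
        rw [this]; ring
      have x2 : b * Real.sin β = l * (a * Real.sin α + b * Real.sin β) := by
        rw [mul_add, hbal, hl1]; ring
      have : t ^ 2 + b ^ 2 - 2 * t * b * Real.cos β
          = (b * Real.cos β - t) ^ 2 + (b * Real.sin β) ^ 2 := by
        linear_combination (-b ^ 2) * e2
      rw [this, x1, hL']
      linear_combination
        (b * Real.sin β + l * (a * Real.sin α + b * Real.sin β)) * x2
    unfold cosSide
    rw [k1, k2, ← hL, Real.sqrt_mul (sq_nonneg m), Real.sqrt_mul (sq_nonneg l),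
      Real.sqrt_sq hm0, Real.sqrt_sq hl0, ← add_mul, add_comm m, hlm, one_mul]

theorem cosArg_mem (p a b : M) (ha : 0 < dist p a) (hb : 0 < dist p b) :
    -1 ≤ (dist p a ^ 2 + dist p b ^ 2 - dist a b ^ 2) / (2 * dist p a * dist p b) ∧
    (dist p a ^ 2 + dist p b ^ 2 - dist a b ^ 2) / (2 * dist p a * dist p b) ≤ 1 := by
  have hpos : 0 < 2 * dist p a * dist p b := by positivity
  have t1 := dist_triangle_left a b p
  have t2 := dist_triangle p a b
  have t3 := dist_triangle_right p a b
  rw [le_div_iff₀ hpos, div_le_iff₀ hpos]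
  have h0 : 0 ≤ dist a b := dist_nonneg
  constructor
  · nlinarith
  · nlinarith [abs_le.2 (⟨by linarith, by linarith⟩ :
      -(dist a b) ≤ dist p a - dist p b ∧ dist p a - dist p b ≤ dist a b),
      sq_le_sq' (by linarith : -(dist a b) ≤ dist p a - dist p b) (by linarith)]

theorem dist_lt_cosSide {p a b : M} {α : ℝ} (ha : 0 < dist p a) (hb : 0 < dist p b)
    (hα : α ≤ Real.pi) (h : compAngle p a b < α) :
    dist a b < cosSide (dist p a) (dist p b) α := by
  have hpos : 0 < 2 * dist p a * dist p b := by positivity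
  obtain ⟨m1, m2⟩ := cosArg_mem p a b ha hb
  have hc := Real.cos_lt_cos_of_nonneg_of_le_pi (compAngle_nonneg p a b) hα h
  rw [compAngle, Real.cos_arccos m1 m2, lt_div_iff₀ hpos] at hc
  apply Real.lt_sqrt_of_sq_lt
  linarith

theorem cosSide_lt_dist {p a b : M} {α : ℝ} (ha : 0 < dist p a) (hb : 0 < dist p b)
    (hα : 0 ≤ α) (h : α < compAngle p a b) :
    cosSide (dist p a) (dist p b) α < dist a b := by
  have hpos : 0 < 2 * dist p a * dist p b := by positivity
  obtain ⟨m1, m2⟩ := cosArg_mem p a b ha hb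
  have hc := Real.cos_lt_cos_of_nonneg_of_le_pi hα (compAngle_le_pi p a b) h
  rw [compAngle, Real.cos_arccos m1 m2, div_lt_iff₀ hpos] at hc
  have hne : 0 < dist a b := by
    refine lt_of_le_of_ne dist_nonneg fun h0 => ?_
    have t1 := dist_triangle p a b
    have t3 := dist_triangle_right p a b
    have e : dist p a = dist p b := by linarith
    rw [← h0, e] at hc
    rw [e] at hpos
    nlinarith [Real.cos_le_one α]
  rw [cosSide, Real.sqrt_lt' hne]
  linarith

theorem gAngle_triangle (c₁ c c₂ : GeodesicFrom x) :
    gAngle c₁ c₂ ≤ gAngle c₁ c + gAngle c c₂ := by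
  by_contra! hlt
  obtain ⟨δ, hδ, hδ'⟩ : ∃ δ > 0, (gAngle c₁ c + δ) + (gAngle c c₂ + δ) < gAngle c₁ c₂ :=
    ⟨(gAngle c₁ c₂ - (gAngle c₁ c + gAngle c c₂)) / 3, by linarith, by linarith⟩
  have hα : 0 < gAngle c₁ c + δ := by linarith [gAngle_nonneg c₁ c]
  have hβ : 0 < gAngle c c₂ + δ := by linarith [gAngle_nonneg c c₂]
  set α := gAngle c₁ c + δ with hαd
  set β := gAngle c c₂ + δ with hβd
  have ev1 := eventually_lt_of_limsup_lt (show gAngle c₁ c < α by linarith)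
    (compAngle_bdd (fun p => (c₁.toFun p.1, c.toFun p.2)) _)
  have ev2 := eventually_lt_of_limsup_lt (show gAngle c c₂ < β by linarith)
    (compAngle_bdd (fun p => (c.toFun p.1, c₂.toFun p.2)) _)
  have fr := frequently_lt_of_lt_limsup
    (compAngle_cobdd (fun p => (c₁.toFun p.1, c₂.toFun p.2)) _) hδ'
  have hb := (nhdsGT_basis (0 : ℝ)).prod_self
  obtain ⟨ε₁, hε₁, H1⟩ := hb.eventually_iff.1 ev1
  obtain ⟨ε₂, hε₂, H2⟩ := hb.eventually_iff.1 ev2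
  obtain ⟨ε, hε, l1, l2, l3, l4, l5⟩ : ∃ ε > 0, ε ≤ ε₁ ∧ ε ≤ ε₂ ∧ ε ≤ c₁.length ∧
      ε ≤ c.length ∧ ε ≤ c₂.length := by
    refine ⟨min ε₁ (min ε₂ (min c₁.length (min c.length c₂.length))), ?_, ?_⟩
    · simp only [gt_iff_lt, lt_min_iff]
      exact ⟨hε₁, hε₂, c₁.length_pos, c.length_pos, c₂.length_pos⟩
    · simp
  obtain ⟨⟨s, r⟩, ⟨⟨hs0, hsε⟩, hr0, hrε⟩, hF⟩ := hb.frequently_iff.1 fr ε hε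
  dsimp only at hs0 hsε hr0 hrε hF
  have hpi : α + β < Real.pi := hF.trans_le (compAngle_le_pi _ _ _)
  obtain ⟨t, ht0, htm, hsum⟩ := exists_point_on_side hs0 hr0 hα hβ hpi
  have htε : t < ε := htm.trans_lt (max_lt hsε hrε)
  have K1 : compAngle x (c₁.toFun s) (c.toFun t) < α :=
    H1 (x := (s, t)) ⟨⟨hs0, hsε.trans_le l1⟩, ht0, htε.trans_le l1⟩
  have K2 : compAngle x (c.toFun t) (c₂.toFun r) < β :=
    H2 (x := (t, r)) ⟨⟨ht0, htε.trans_le l2⟩, hr0, hrε.trans_le l2⟩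
  have ds := dist_start c₁ hs0.le (hsε.le.trans l3)
  have dt := dist_start c ht0.le (htε.le.trans l4)
  have dr := dist_start c₂ hr0.le (hrε.le.trans l5)
  have I1 := dist_lt_cosSide (by rwa [ds]) (by rwa [dt]) (by linarith) K1
  have I2 := dist_lt_cosSide (by rwa [dt]) (by rwa [dr]) (by linarith) K2
  have I3 := cosSide_lt_dist (by rwa [ds]) (by rwa [dr]) (by linarith) hF
  rw [ds, dt] at I1
  rw [dt, dr] at I2
  rw [ds, dr] at I3
  have := dist_triangle (c₁.toFun s) (c.toFun t) (c₂.toFun r)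
  linarith

end angle

/-- Geodesics starting at `x`, with the angle as (pseudo-)distance. -/
instance {M : Type*} [PseudoMetricSpace M] (x : M) : PseudoMetricSpace (GeodesicFrom x) where
  dist := gAngle
  dist_self := gAngle_self
  dist_comm := gAngle_comm
  dist_triangle := gAngle_triangle

/-- The space of directions `Σₓ` at `x`: geodesics starting at `x`, identified if
their angle is zero, with the angle as metric. (For points of spherical buildings this space is
complete, so that it agrees with its completion.) -/
abbrev Directions {M : Type*} [PseudoMetricSpace M] (x : M) : Type _ :=
  SeparationQuotient (GeodesicFrom x)

/-- The set `ΣₓC` of directions at `x` of geodesics that start at `x` and run in `C`. -/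
def directionsOf {M : Type*} [PseudoMetricSpace M] (C : Set M) (x : M) : Set (Directions x) :=
  {v | ∃ c : GeodesicFrom x, (∀ t ∈ Set.Icc 0 c.length, c.toFun t ∈ C) ∧
    SeparationQuotient.mk c = v}

end SphBuild

end

/-! The core is a containment result: a nonempty convex spherical subset of a building lies in an
apartment (`exists_isConeChart_superset`). It is used twice. First it puts C into the image of a
chart k with k u = x; let z = k (-u). Every direction at x starts exactly one geodesic of length π
from x to z, and angles at x determine the distances between points of these geodesics
(`IsRayFamily`). Hence the geodesics with directions in A_x form the suspension of A_x, an
isometrically embedded n-sphere. This sphere is itself convex and spherical, so it lies in an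
apartment, and it fills the apartment because isometric self-maps of a round sphere are onto. Its
directions at x are A_x. It contains C: a point of C other than x and z lies on a half circle of k
from x to z that starts inside C by convexity, so its direction is in A_x.

For the containment, fix a point of C on as few walls as possible. Any two charts through it agree
at some point further along each segment to a point of C at distance less than π. If an apartment
through it misses such a point y, prolonging the segment backwards inside the apartment leads to an
antipode of y. `exists_antipodal` replaces the apartment by one through y with the same germ at that
antipode, and sphericality of C ensures that no point of C is lost (`exists_extension`). There are
finitely many cells, so a maximal apartment exists.

The local tool is `eq_of_dominates`: charts that agree at a point agree on its closed cell, because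
W is finite. CAT(1) enters through uniqueness of geodesics shorter than π and through the fact that
local geodesics of length at most π are geodesics. -/

noncomputable section

namespace SphBuild

open InnerProductGeometry
open scoped RealInnerProductSpace

/-! ### Great circles and angles in an inner product space -/

section circle

variable {V : Type*} [NormedAddCommGroup V] [InnerProductSpace ℝ V]

/-- The point at distance `t` from `u` on the great circle through the unit vector `u`
with direction `e`. -/
def circ (u e : V) (t : ℝ) : V := Real.cos t • u + Real.sin t • e

@[simp] theorem circ_zero (u e : V) : circ u e 0 = u := by simp [circ]

@[simp] theorem circ_pi (u e : V) : circ u e Real.pi = -u := by simp [circ]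

/-- The spherical law of cosines at the vertex u, with ⟪e, e'⟫ as the cosine of the angle when e and
e' are unit vectors. -/
theorem inner_circ {u e e' : V} (hu : ‖u‖ = 1) (h : ⟪u, e⟫ = 0) (h' : ⟪u, e'⟫ = 0) (s t : ℝ) :
    ⟪circ u e s, circ u e' t⟫
      = Real.cos s * Real.cos t + Real.sin s * Real.sin t * ⟪e, e'⟫ := by
  have h2 : ⟪e, u⟫ = 0 := by rw [real_inner_comm, h]
  simp only [circ, inner_add_left, inner_add_right, real_inner_smul_left, real_inner_smul_right,
    h2, h', real_inner_self_eq_norm_sq, hu]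
  ring

theorem inner_self_of_norm_one {x : V} (hx : ‖x‖ = 1) : ⟪x, x⟫ = 1 := by
  rw [real_inner_self_eq_norm_sq, hx, one_pow]

theorem norm_circ {u e : V} (hu : ‖u‖ = 1) (he : ‖e‖ = 1) (h : ⟪u, e⟫ = 0) (t : ℝ) :
    ‖circ u e t‖ = 1 := by
  have := inner_circ hu h h t t
  rw [real_inner_self_eq_norm_sq, real_inner_self_eq_norm_sq, he] at this
  have h1 : ‖circ u e t‖ ^ 2 = 1 := by
    rw [this]; nlinarith [Real.sin_sq_add_cos_sq t]
  exact (pow_eq_one_iff_of_nonneg (norm_nonneg _) two_ne_zero).1 h1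

theorem angle_eq_of_inner_eq_cos {x y : V} (hx : ‖x‖ = 1) (hy : ‖y‖ = 1) {t : ℝ} (h0 : 0 ≤ t)
    (ht : t ≤ Real.pi) (h : ⟪x, y⟫ = Real.cos t) : angle x y = t := by
  rw [angle, hx, hy, h]
  simp [Real.arccos_cos h0 ht]

theorem angle_circ {u e : V} (hu : ‖u‖ = 1) (he : ‖e‖ = 1) (h : ⟪u, e⟫ = 0) {s t : ℝ}
    (hst : |s - t| ≤ Real.pi) : angle (circ u e s) (circ u e t) = |s - t| := by
  refine angle_eq_of_inner_eq_cos (norm_circ hu he h _) (norm_circ hu he h _) (abs_nonneg _)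
    hst ?_
  rw [inner_circ hu h h, Real.cos_abs, Real.cos_sub, real_inner_self_eq_norm_sq, he]
  ring

theorem ne_zero_of_norm_one {V : Type*} [NormedAddCommGroup V] {x : V} (hx : ‖x‖ = 1) : x ≠ 0 := by
  rintro rfl
  simp at hx

theorem exists_circ {u y : V} (hu : ‖u‖ = 1) (hy : ‖y‖ = 1) (h0 : 0 < angle u y)
    (hpi : angle u y < Real.pi) :
    ∃ e, ‖e‖ = 1 ∧ ⟪u, e⟫ = 0 ∧ y = circ u e (angle u y) := by
  have hs : 0 < Real.sin (angle u y) := Real.sin_pos_of_pos_of_lt_pi h0 hpi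
  have hc : ⟪u, y⟫ = Real.cos (angle u y) := inner_eq_cos_angle_of_norm_eq_one hu hy
  have hc' : ⟪y, u⟫ = Real.cos (angle u y) := by rw [real_inner_comm, hc]
  set θ := angle u y
  refine ⟨(Real.sin θ)⁻¹ • (y - Real.cos θ • u), ?_, ?_, ?_⟩
  · have : ‖y - Real.cos θ • u‖ ^ 2 = Real.sin θ ^ 2 := by
      rw [← real_inner_self_eq_norm_sq]
      simp only [inner_sub_left, inner_sub_right, real_inner_smul_left, real_inner_smul_right,
        hc, hc', inner_self_of_norm_one hu, inner_self_of_norm_one hy]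
      nlinarith [Real.sin_sq_add_cos_sq θ]
    have h2 := (pow_left_inj₀ (norm_nonneg _) hs.le two_ne_zero).1 this
    rw [norm_smul, h2, norm_inv, Real.norm_of_nonneg hs.le, inv_mul_cancel₀ hs.ne']
  · rw [real_inner_smul_right, inner_sub_right, real_inner_smul_right, hc,
      real_inner_self_eq_norm_sq, hu]
    simp
  · rw [circ, smul_smul, mul_inv_cancel₀ hs.ne', one_smul]
    abel

theorem angle_add_of_comb {x y z : V} (hy : y ≠ 0) {a b : ℝ} (ha : 0 ≤ a) (hb : 0 ≤ b)
    (h : y = a • x + b • z) : angle x z = angle x y + angle y z := by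
  apply angle_eq_angle_add_add_angle_add_of_mem_span hy
  rw [Submodule.mem_span_pair]
  exact ⟨⟨a, ha⟩, ⟨b, hb⟩, by rw [h]; rfl⟩

/-- Additive angles put x, m, y on one great circle, so y is an explicit combination of x and m. The
squared norm of the difference of the two sides is a trigonometric expression that vanishes
identically. -/
theorem sin_smul_of_angle_add {x m y : V} (hx : ‖x‖ = 1) (hm : ‖m‖ = 1) (hy : ‖y‖ = 1)
    {α β : ℝ} (h1 : angle x m = α) (h2 : angle m y = β) (h3 : angle x y = α + β) :
    Real.sin α • y = Real.sin (α + β) • m - Real.sin β • x := by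
  have i1 := inner_eq_cos_angle_of_norm_eq_one hx hm
  have i2 := inner_eq_cos_angle_of_norm_eq_one hm hy
  have i3 := inner_eq_cos_angle_of_norm_eq_one hx hy
  rw [h1] at i1
  rw [h2] at i2
  rw [h3] at i3
  have i1' : ⟪m, x⟫ = Real.cos α := by rw [real_inner_comm, i1]
  have i2' : ⟪y, m⟫ = Real.cos β := by rw [real_inner_comm, i2]
  have i3' : ⟪y, x⟫ = Real.cos (α + β) := by rw [real_inner_comm, i3]
  rw [← sub_eq_zero, ← norm_eq_zero, ← sq_eq_zero_iff, ← real_inner_self_eq_norm_sq]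
  simp only [inner_sub_left, inner_sub_right, real_inner_smul_left, real_inner_smul_right,
    i1, i2, i3, i1', i2', i3', inner_self_of_norm_one hx, inner_self_of_norm_one hm,
    inner_self_of_norm_one hy]
  rw [Real.sin_add, Real.cos_add]
  have e1 := Real.sin_sq_add_cos_sq α
  have e2 := Real.sin_sq_add_cos_sq β
  have e1' : Real.cos α ^ 2 = 1 - Real.sin α ^ 2 := by linarith
  have e2' : Real.cos β ^ 2 = 1 - Real.sin β ^ 2 := by linarith
  ring_nf
  simp only [e1', e2']
  ring

end circle

/-! ### Geodesics in CAT(1) spaces -/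

section CAT1

variable {M : Type*} [MetricSpace M]

theorem Between.symm {a z b : M} (h : Between a z b) : Between b z a := by
  unfold Between at *
  rw [dist_comm b z, dist_comm z a, dist_comm b a, ← h, add_comm]

/-- The vector with the given coordinates. -/
def vec (a b c : ℝ) : E 3 := !₂[a, b, c]

theorem norm_vec {a b c : ℝ} (h : a ^ 2 + b ^ 2 + c ^ 2 = 1) : ‖vec a b c‖ = 1 := by
  rw [EuclideanSpace.norm_eq]
  simp [vec, Fin.sum_univ_three, h]

theorem inner_vec (a b c a' b' c' : ℝ) :
    ⟪vec a b c, vec a' b' c'⟫ = a * a' + b * b' + c * c' := by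
  simp [vec, PiLp.inner_apply, Fin.sum_univ_three, mul_comm]

/-- Comparison triangles exist: place m at the first basis vector and p in the first coordinate
plane. The number k is the cosine of the angle at m, read off from the law of cosines; the triangle
inequalities and the perimeter bound give |k| ≤ 1. -/
theorem exists_comparison {α β γ s : ℝ} (h1 : α ≤ β + γ) (h2 : β ≤ α + γ) (h3 : γ ≤ α + β)
    (hp : α + β + γ < 2 * Real.pi) (hs0 : 0 ≤ s) (hs : s ≤ α) :
    ∃ m p r a : E 3, ‖m‖ = 1 ∧ ‖p‖ = 1 ∧ ‖r‖ = 1 ∧ ‖a‖ = 1 ∧ angle m p = α ∧ angle p r = β ∧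
      angle m r = γ ∧ angle m a = s ∧ angle a p = α - s := by
  have hα : α < Real.pi := by linarith
  have hβ : β < Real.pi := by linarith
  have hγ : γ < Real.pi := by linarith
  have hα0 : 0 ≤ α := by linarith
  have hγ0 : 0 ≤ γ := by linarith
  have hβ0 : 0 ≤ β := by linarith
  obtain ⟨k, hk1, hk⟩ : ∃ k : ℝ, k ^ 2 ≤ 1 ∧
      Real.cos α * Real.cos γ + Real.sin α * Real.sin γ * k = Real.cos β := by
    rcases hα0.eq_or_lt with h | hα'
    · subst h
      exact ⟨0, by norm_num, by simp; congr 1; linarith⟩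
    rcases hγ0.eq_or_lt with h | hγ'
    · subst h
      exact ⟨0, by norm_num, by simp; congr 1; linarith⟩
    have sα := Real.sin_pos_of_pos_of_lt_pi hα' hα
    have sγ := Real.sin_pos_of_pos_of_lt_pi hγ' hγ
    have c1 : Real.cos β ≤ Real.cos (α - γ) := by
      rw [← Real.cos_abs (α - γ)]
      exact Real.cos_le_cos_of_nonneg_of_le_pi (abs_nonneg _) hβ.le
        (abs_le.2 ⟨by linarith, by linarith⟩)
    have c2 : Real.cos (α + γ) ≤ Real.cos β := by
      rcases le_total (α + γ) Real.pi with h | h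
      · exact Real.cos_le_cos_of_nonneg_of_le_pi hβ0 h h2
      · rw [← Real.cos_two_pi_sub (α + γ)]
        exact Real.cos_le_cos_of_nonneg_of_le_pi hβ0 (by linarith) (by linarith)
    rw [Real.cos_sub] at c1
    rw [Real.cos_add] at c2
    refine ⟨(Real.cos β - Real.cos α * Real.cos γ) / (Real.sin α * Real.sin γ), ?_, ?_⟩
    · rw [sq_le_one_iff_abs_le_one, abs_le, le_div_iff₀ (by positivity),
        div_le_iff₀ (by positivity)]
      constructor <;> linarith
    · rw [mul_div_cancel₀ _ (by positivity)]
      ring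
  have e1 := Real.sin_sq_add_cos_sq α
  have e2 := Real.sin_sq_add_cos_sq γ
  have e3 := Real.sin_sq_add_cos_sq s
  have hq : Real.sqrt (1 - k ^ 2) ^ 2 = 1 - k ^ 2 := Real.sq_sqrt (by linarith)
  have n1 : ‖vec 1 0 0‖ = 1 := norm_vec (by norm_num)
  have n2 : ‖vec (Real.cos α) (Real.sin α) 0‖ = 1 := norm_vec (by linarith)
  have n3 : ‖vec (Real.cos γ) (Real.sin γ * k) (Real.sin γ * Real.sqrt (1 - k ^ 2))‖ = 1 :=
    norm_vec (by rw [mul_pow, mul_pow, hq]; linarith)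
  have n4 : ‖vec (Real.cos s) (Real.sin s) 0‖ = 1 := norm_vec (by linarith)
  refine ⟨_, _, _, _, n1, n2, n3, n4, ?_, ?_, ?_, ?_, ?_⟩
  · exact angle_eq_of_inner_eq_cos n1 n2 hα0 hα.le (by rw [inner_vec]; ring)
  · exact angle_eq_of_inner_eq_cos n2 n3 hβ0 hβ.le (by rw [inner_vec, ← hk]; ring)
  · exact angle_eq_of_inner_eq_cos n1 n3 hγ0 hγ.le (by rw [inner_vec]; ring)
  · exact angle_eq_of_inner_eq_cos n1 n4 hs0 (by linarith) (by rw [inner_vec]; ring)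
  · exact angle_eq_of_inner_eq_cos n4 n2 (by linarith) (by linarith)
      (by rw [inner_vec, Real.cos_sub]; ring)

/-- Points of the unit sphere from unit vectors. -/
def toSphere {d : ℕ} (x : E d) (h : ‖x‖ = 1) : USphere d := ⟨x, by simp [h]⟩

/-- The comparison inequality for a point on a side and the opposite vertex. -/
theorem IsCAT1.exists_vertex_comparison (hM : IsCAT1 M) {m p r a : M}
    (hper : dist m p + dist p r + dist m r < 2 * Real.pi) (ha : Between m a p) :
    ∃ m' p' r' a' : E 3, ‖m'‖ = 1 ∧ ‖p'‖ = 1 ∧ ‖r'‖ = 1 ∧ ‖a'‖ = 1 ∧ angle m' p' = dist m p ∧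
      angle p' r' = dist p r ∧ angle m' r' = dist m r ∧ angle m' a' = dist m a ∧
      angle a' p' = dist a p ∧ dist a r ≤ angle a' r' := by
  have hb : dist a p = dist m p - dist m a := by unfold Between at ha; linarith
  obtain ⟨m', p', r', a', hm, hp, hr, ha', h1, h2, h3, h4, h5⟩ :=
    exists_comparison (α := dist m p) (β := dist p r) (γ := dist m r) (s := dist m a)
      (by linarith [dist_triangle m r p, dist_comm r p])
      (by linarith [dist_triangle p m r, dist_comm m p])
      (by linarith [dist_triangle m p r]) hper dist_nonneg
      (by unfold Between at ha; linarith [dist_nonneg (x := a) (y := p)])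
  refine ⟨m', p', r', a', hm, hp, hr, ha', h1, h2, h3, h4, h5.trans hb.symm, ?_⟩
  exact hM.comparison m p r a r (by rw [dist_comm r m]; exact hper) ha
    (by unfold Between; rw [dist_self, add_zero]) (toSphere m' hm) (toSphere p' hp)
    (toSphere r' hr) (toSphere a' ha') (toSphere r' hr) h1 h2
    (by rw [dist_comm r m, ← h3]; exact angle_comm _ _) h4 (h5.trans hb.symm) h3
    (by rw [dist_self]; exact angle_self (ne_zero_of_norm_one hr))

/-- Geodesics of length less than `π` are unique. -/
theorem IsCAT1.eq_of_between (hM : IsCAT1 M) {p q a b : M} (h : dist p q < Real.pi)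
    (ha : Between p a q) (hb : Between p b q) (hab : dist p a = dist p b) : a = b := by
  have hpos : 0 < Real.pi := Real.pi_pos
  have hq : dist a q = dist b q := by unfold Between at ha hb; linarith
  -- The degenerate triangle p, q, q: its comparison triangle is a segment, on which a and b have
  -- the same comparison point.
  obtain ⟨m', p', r', a', hm, hp, hr, ha', h1, h2, h3, h4, h5⟩ :=
    exists_comparison (α := dist p q) (β := 0) (γ := dist p q) (s := dist p a)
      (by linarith) (by linarith [dist_nonneg (x := p) (y := q)]) (by linarith) (by linarith)
      dist_nonneg (by unfold Between at ha; linarith [dist_nonneg (x := a) (y := q)])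
  have hpr : p' = r' := eq_of_angle_eq_zero_of_norm_eq h2 (hp.trans hr.symm)
  subst hpr
  have hb' : dist a q = dist p q - dist p a := by unfold Between at ha; linarith
  have := hM.comparison p q q a b (by rw [dist_self, dist_comm q p]; linarith) ha hb
    (toSphere m' hm) (toSphere p' hp) (toSphere p' hp) (toSphere a' ha') (toSphere a' ha') h1
    (by rw [dist_self]; exact h2) (by rw [dist_comm q p, ← h1]; exact angle_comm _ _) h4
    (h5.trans hb'.symm) (h4.trans hab) (h5.trans (hb'.symm.trans hq))
  have h0 : angDist (toSphere a' ha') (toSphere a' ha') = 0 :=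
    angle_self (ne_zero_of_norm_one ha')
  exact dist_le_zero.1 (this.trans h0.le)

/-- Local geodesics of length at most `π` are geodesics. -/
theorem IsCAT1.between_of_between (hM : IsCAT1 M) {p a m r : M} (h1 : Between p a m)
    (h2 : Between a m r) (ham : a ≠ m) (hpi : dist p m + dist m r ≤ Real.pi) :
    Between p m r := by
  by_contra hne
  have hlt : dist p r < dist p m + dist m r :=
    lt_of_le_of_ne (dist_triangle _ _ _) fun h => hne h.symm
  obtain ⟨m', p', r', a', hm, hp, hr, ha', i1, i2, i3, i4, i5, i6⟩ :=
    hM.exists_vertex_comparison (m := m) (p := p) (r := r) (a := a)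
      (by rw [dist_comm m p]; linarith) h1.symm
  unfold Between at h1 h2
  have hα : 0 < dist a m := dist_pos.2 ham
  have hmp : dist p a + dist a m = dist m p := by rw [h1, dist_comm]
  have j1 : angle a' m' = dist a m := by rw [angle_comm, i4, dist_comm]
  have j2 : angle a' r' = dist a m + dist m r := by
    apply le_antisymm
    · rw [← j1, ← i3]
      exact angle_le_angle_add_angle _ _ _
    · rw [h2]; exact i6
  -- The comparison inequality turns the triangle inequality at m' into an equality. So a', m', r'
  -- lie on a great circle, which also contains p'; its arc from p' to r' has length δ + α + β.
  have key := sin_smul_of_angle_add ha' hm hr j1 i3 j2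
  have key2 := congrArg (fun v => ⟪p', v⟫) key
  simp only [inner_sub_right, real_inner_smul_right] at key2
  rw [inner_eq_cos_angle_of_norm_eq_one hp hr, inner_eq_cos_angle_of_norm_eq_one hp hm,
    inner_eq_cos_angle_of_norm_eq_one hp ha', angle_comm p' m', i1, angle_comm p' a', i5, i2,
    ← hmp, dist_comm a p] at key2
  set δ := dist p a
  set α := dist a m
  set β := dist m r
  have hδ : 0 ≤ δ := dist_nonneg
  have hβ : 0 ≤ β := dist_nonneg
  have hsin : 0 < Real.sin α := Real.sin_pos_of_pos_of_lt_pi hα (by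
    rcases (show α ≤ Real.pi by linarith).eq_or_lt with h | h
    · exfalso
      have b0 : β = 0 := by linarith
      have : m = r := dist_eq_zero.1 b0
      apply hne
      unfold Between
      rw [this, dist_self, add_zero]
    · exact h)
  have e : Real.sin (α + β) * Real.cos (δ + α) - Real.sin β * Real.cos δ
      = Real.sin α * Real.cos (δ + α + β) := by
    rw [Real.cos_add (δ + α) β, Real.cos_add, Real.sin_add, Real.sin_add δ α]
    linear_combination (Real.sin β * Real.cos δ) * Real.sin_sq_add_cos_sq α
  rw [e] at key2
  have hcos := mul_left_cancel₀ hsin.ne' key2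
  have := Real.injOn_cos ⟨dist_nonneg, by linarith⟩ ⟨by positivity, by linarith⟩ hcos
  linarith

end CAT1

/-! ### Charts on the cone over the sphere -/

namespace SphericalBuilding

variable {n : ℕ} {B : Type*} [MetricSpace B] {X : SphericalBuilding n B}

/-- A chart, extended to nonzero vectors by radial projection to the unit sphere. -/
def IsConeChart (X : SphericalBuilding n B) (k : E (n + 1) → B) : Prop :=
  ∃ ι ∈ X.charts, ∀ (u : E (n + 1)) (hu : ‖u‖ = 1) (r : ℝ), 0 < r → k (r • u) = ι (toSphere u hu)

theorem norm_unit {x : E (n + 1)} (hx : x ≠ 0) : ‖‖x‖⁻¹ • x‖ = 1 := by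
  rw [norm_smul, norm_inv, norm_norm, inv_mul_cancel₀ (norm_ne_zero_iff.2 hx)]

theorem norm_smul_unit {x : E (n + 1)} (hx : x ≠ 0) : ‖x‖ • ‖x‖⁻¹ • x = x := by
  rw [smul_smul, mul_inv_cancel₀ (norm_ne_zero_iff.2 hx), one_smul]

theorem exists_isConeChart {ι : USphere (n + 1) → B} (hι : ι ∈ X.charts) :
    ∃ k, X.IsConeChart k ∧ ∀ u (hu : ‖u‖ = 1), k u = ι (toSphere u hu) := by
  classical
  let k : E (n + 1) → B := fun x =>
    -- The origin has no radial projection; its value is arbitrary.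
    if h : x = 0 then ι (toSphere (EuclideanSpace.single 0 1) (by simp))
    else ι (toSphere (‖x‖⁻¹ • x) (norm_unit h))
  have hk : ∀ (u : E (n + 1)) (hu : ‖u‖ = 1) (r : ℝ), 0 < r →
      k (r • u) = ι (toSphere u hu) := by
    intro u hu r hr
    have h0 : r • u ≠ 0 := smul_ne_zero hr.ne' (ne_zero_of_norm_one hu)
    have : ‖r • u‖⁻¹ • r • u = u := by
      rw [norm_smul, hu, mul_one, Real.norm_of_nonneg hr.le, smul_smul, inv_mul_cancel₀ hr.ne',
        one_smul]
    simp only [k, dif_neg h0, this]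
  exact ⟨k, ⟨ι, hι, hk⟩, fun u hu => by simpa using hk u hu 1 one_pos⟩

namespace IsConeChart

theorem dist_eq {k : E (n + 1) → B} (hk : X.IsConeChart k) {x y : E (n + 1)} (hx : x ≠ 0)
    (hy : y ≠ 0) : dist (k x) (k y) = angle x y := by
  obtain ⟨ι, hι, h⟩ := hk
  have h1 := h _ (norm_unit hx) _ (norm_pos_iff.2 hx)
  have h2 := h _ (norm_unit hy) _ (norm_pos_iff.2 hy)
  rw [norm_smul_unit hx] at h1
  rw [norm_smul_unit hy] at h2
  rw [h1, h2, X.isometric ι hι]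
  unfold angDist toSphere
  simp only
  rw [angle_smul_left_of_pos _ _ (inv_pos.2 (norm_pos_iff.2 hx)),
    angle_smul_right_of_pos _ _ (inv_pos.2 (norm_pos_iff.2 hy))]

theorem apply_smul {k : E (n + 1) → B} (hk : X.IsConeChart k) {x : E (n + 1)} (hx : x ≠ 0)
    {r : ℝ} (hr : 0 < r) : k (r • x) = k x := by
  rw [← dist_eq_zero, hk.dist_eq (smul_ne_zero hr.ne' hx) hx, angle_smul_left_of_pos _ _ hr,
    angle_self hx]

theorem continuousAt {k : E (n + 1) → B} (hk : X.IsConeChart k) {x : E (n + 1)} (hx : x ≠ 0) :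
    ContinuousAt k x := by
  have h : ContinuousAt (fun y => angle y x) x :=
    ContinuousAt.comp (f := fun y => (y, x)) (g := fun p : E (n + 1) × E (n + 1) => angle p.1 p.2)
      (continuousAt_angle hx hx) (by fun_prop)
  rw [ContinuousAt, tendsto_iff_dist_tendsto_zero]
  have h' := h.tendsto
  rw [angle_self hx] at h'
  refine h'.congr' ?_
  filter_upwards [isOpen_ne.mem_nhds hx] with y hy
  rw [hk.dist_eq hy hx]

theorem comp {k : E (n + 1) → B} (hk : X.IsConeChart k) {w : E (n + 1) ≃ₗᵢ[ℝ] E (n + 1)}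
    (hw : w ∈ X.W) : X.IsConeChart (k ∘ w) := by
  obtain ⟨ι, hι, h⟩ := hk
  refine ⟨ι ∘ sphereMap w, X.comp_mem ι hι w hw, fun u hu r hr => ?_⟩
  have := h (w u) (by rw [w.norm_map, hu]) r hr
  simp only [Function.comp, map_smul, this]
  rfl

theorem exists_mem_W {k₁ k₂ : E (n + 1) → B} (h₁ : X.IsConeChart k₁) (h₂ : X.IsConeChart k₂) :
    ∃ w ∈ X.W, ∀ x y, ‖x‖ = 1 → ‖y‖ = 1 → k₁ x = k₂ y → x = w y := by
  obtain ⟨ι₁, hι₁, h1⟩ := h₁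
  obtain ⟨ι₂, hι₂, h2⟩ := h₂
  obtain ⟨w, hw, H⟩ := X.compatible ι₁ hι₁ ι₂ hι₂
  refine ⟨w, hw, fun x y hx hy hxy => ?_⟩
  have e1 := h1 x hx 1 one_pos
  have e2 := h2 y hy 1 one_pos
  rw [one_smul] at e1 e2
  exact congrArg Subtype.val (H (toSphere x hx) (toSphere y hy) (by rw [← e1, ← e2, hxy]))

end IsConeChart

theorem exists_isConeChart_pair (X : SphericalBuilding n B) (a b : B) :
    ∃ k, X.IsConeChart k ∧ ∃ x y, ‖x‖ = 1 ∧ ‖y‖ = 1 ∧ k x = a ∧ k y = b := by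
  obtain ⟨ι, hι, ⟨u, rfl⟩, ⟨v, rfl⟩⟩ := X.plenty a b
  obtain ⟨k, hk, h⟩ := exists_isConeChart hι
  have hu : ‖(u : E (n + 1))‖ = 1 := by simp
  have hv : ‖(v : E (n + 1))‖ = 1 := by simp
  exact ⟨k, hk, u, v, hu, hv, h _ hu, h _ hv⟩

theorem dist_le_pi (X : SphericalBuilding n B) (a b : B) : dist a b ≤ Real.pi := by
  obtain ⟨k, hk, x, y, hx, hy, rfl, rfl⟩ := X.exists_isConeChart_pair a b
  rw [hk.dist_eq (ne_zero_of_norm_one hx) (ne_zero_of_norm_one hy)]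
  exact angle_le_pi _ _

namespace IsConeChart

/-- Take any chart through k x and b and precompose it with an element of W, so that the first point
gets the coordinate x again. -/
theorem exists_through {k : E (n + 1) → B} (hk : X.IsConeChart k) {x : E (n + 1)} (hx : x ≠ 0)
    (b : B) : ∃ k', X.IsConeChart k' ∧ k' x = k x ∧ ∃ y, ‖y‖ = 1 ∧ k' y = b := by
  obtain ⟨k₁, hk₁, x', y', hx', hy', ex, ey⟩ := X.exists_isConeChart_pair (k x) b
  obtain ⟨w, hw, H⟩ := hk₁.exists_mem_W hk
  have e := hk.apply_smul hx (inv_pos.2 (norm_pos_iff.2 hx))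
  have hwx := H x' (‖x‖⁻¹ • x) hx' (norm_unit hx) (by rw [ex, e])
  have hk' := hk₁.comp hw
  refine ⟨k₁ ∘ w, hk', ?_, w.symm y', by rw [LinearIsometryEquiv.norm_map, hy'], ?_⟩
  · rw [← hk'.apply_smul hx (inv_pos.2 (norm_pos_iff.2 hx)), Function.comp, ← hwx, ex]
  · simp [ey]

theorem map_neg_eq {k : E (n + 1) → B} (hk : X.IsConeChart k) {x y : E (n + 1)} (hx : x ≠ 0)
    (hy : y ≠ 0) (h : dist (k x) (k y) = Real.pi) : k (-x) = k y := by
  rw [hk.dist_eq hx hy] at h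
  obtain ⟨-, r, hr, rfl⟩ := angle_eq_pi_iff.1 h
  rw [← hk.apply_smul (neg_ne_zero.2 hx) (neg_pos.2 hr)]
  simp

theorem between {k : E (n + 1) → B} (hk : X.IsConeChart k) {x y z : E (n + 1)} (hx : x ≠ 0)
    (hy : y ≠ 0) (hz : z ≠ 0) {a b : ℝ} (ha : 0 ≤ a) (hb : 0 ≤ b) (h : y = a • x + b • z) :
    Between (k x) (k y) (k z) := by
  unfold Between
  rw [hk.dist_eq hx hy, hk.dist_eq hy hz, hk.dist_eq hx hz, angle_add_of_comb hy ha hb h]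

/-- The set on which two charts agree is convex. -/
theorem eq_of_comb {k₁ k₂ : E (n + 1) → B} (h₁ : X.IsConeChart k₁) (h₂ : X.IsConeChart k₂)
    {x y z : E (n + 1)} (hx : x ≠ 0) (hy : y ≠ 0) (hz : z ≠ 0) (ex : k₁ x = k₂ x)
    (ez : k₁ z = k₂ z) {a b : ℝ} (ha : 0 ≤ a) (hb : 0 ≤ b) (h : y = a • x + b • z) :
    k₁ y = k₂ y := by
  rcases (angle_le_pi x z).eq_or_lt with hpi | hlt
  · obtain ⟨-, r, hr, rfl⟩ := angle_eq_pi_iff.1 hpi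
    have hc : y = (a + b * r) • x := by rw [h, smul_smul, add_smul]
    rcases lt_trichotomy (a + b * r) 0 with hn | h0 | hp
    · have hy' : y = ((a + b * r) / r) • r • x := by
        rw [smul_smul, div_mul_cancel₀ _ hr.ne, hc]
      have hpos : 0 < (a + b * r) / r := div_pos_of_neg_of_neg hn hr
      rw [hy', h₁.apply_smul hz hpos, h₂.apply_smul hz hpos, ez]
    · rw [h0, zero_smul] at hc
      exact absurd hc hy
    · rw [hc, h₁.apply_smul hx hp, h₂.apply_smul hx hp, ex]
  · refine X.cat1.eq_of_between (p := k₁ x) (q := k₁ z) ?_ (h₁.between hx hy hz ha hb h) ?_ ?_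
    · rwa [h₁.dist_eq hx hz]
    · rw [ex, ez]
      exact h₂.between hx hy hz ha hb h
    · rw [h₁.dist_eq hx hy, ex, h₂.dist_eq hx hy]

end IsConeChart

/-! ### Cells -/

/-- The finitely many linear functionals whose signs determine the stabilizer of a vector
in the Weyl group: the coordinates of `x` and of `w x - x`. -/
def cellFn (X : SphericalBuilding n B) (j : Option X.W × Fin (n + 1)) : E (n + 1) →L[ℝ] ℝ :=
  match j.1 with
  | none => EuclideanSpace.proj j.2
  | some w => (EuclideanSpace.proj j.2).comp
      (((w : E (n + 1) ≃ₗᵢ[ℝ] E (n + 1)) : E (n + 1) →L[ℝ] E (n + 1)) -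
        ContinuousLinearMap.id ℝ (E (n + 1)))

instance : Finite X.W := X.isReflectionGroup.1

theorem cellFn_some (w : X.W) (i : Fin (n + 1)) (x : E (n + 1)) :
    X.cellFn (some w, i) x = (w : E (n + 1) ≃ₗᵢ[ℝ] E (n + 1)) x i - x i := rfl

theorem fixed_iff (w : X.W) (x : E (n + 1)) :
    (w : E (n + 1) ≃ₗᵢ[ℝ] E (n + 1)) x = x ↔ ∀ i, X.cellFn (some w, i) x = 0 := by
  simp only [cellFn_some, sub_eq_zero]
  exact ⟨fun h i => by rw [h], fun h => by ext i; exact h i⟩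

/-- This is why the coordinates belong to `cellFn`: the segment from a dominating vector to a
nonzero one then avoids the origin, where charts are meaningless. -/
theorem exists_cellFn_ne_zero (X : SphericalBuilding n B) {x : E (n + 1)} (hx : x ≠ 0) :
    ∃ j, X.cellFn j x ≠ 0 := by
  by_contra! h
  exact hx (by ext i; exact h (none, i))

/-- The closure of the cell of `q` contains `p`. -/
def Dominates (X : SphericalBuilding n B) (q p : E (n + 1)) : Prop :=
  ∀ j, X.cellFn j p ≠ 0 → SignType.sign (X.cellFn j q) = SignType.sign (X.cellFn j p)

theorem eventually_dominates (X : SphericalBuilding n B) (p : E (n + 1)) :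
    ∀ᶠ x in 𝓝 p, X.Dominates x p := by
  unfold Dominates
  rw [eventually_all]
  intro j
  by_cases h : X.cellFn j p = 0
  · simp [h]
  · have hc : ContinuousAt (X.cellFn j) p := (X.cellFn j).continuous.continuousAt
    rcases lt_or_gt_of_ne h with h' | h'
    · filter_upwards [hc.eventually (gt_mem_nhds h')] with x hx _
      rw [sign_neg hx, sign_neg h']
    · filter_upwards [hc.eventually (lt_mem_nhds h')] with x hx _
      rw [sign_pos hx, sign_pos h']

theorem Dominates.ne_zero {q p : E (n + 1)} (h : X.Dominates q p) (hp : p ≠ 0) : q ≠ 0 := by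
  obtain ⟨j, hj⟩ := X.exists_cellFn_ne_zero hp
  rintro rfl
  have := h j hj
  rw [map_zero, sign_zero, eq_comm, sign_eq_zero_iff] at this
  exact hj this

theorem Dominates.neg {q p : E (n + 1)} (h : X.Dominates q p) : X.Dominates (-q) (-p) := by
  intro j hj
  rw [map_neg (X.cellFn j) q, map_neg (X.cellFn j) p, Left.sign_neg (α := ℝ), Left.sign_neg (α := ℝ), h j (by simpa using hj)]

/-- The values at q and p never have opposite signs, so a segment from q to p meets no new wall
before reaching p. -/
theorem Dominates.comb_ne_zero {q p : E (n + 1)} (h : X.Dominates q p) {j}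
    (hq : X.cellFn j q ≠ 0) {a b : ℝ} (ha : 0 < a) (hb : 0 ≤ b) :
    X.cellFn j (a • q + b • p) ≠ 0 := by
  rw [map_add, map_smul, map_smul, smul_eq_mul, smul_eq_mul]
  by_cases hp : X.cellFn j p = 0
  · rw [hp, mul_zero, add_zero]
    exact mul_ne_zero ha.ne' hq
  · have hs := h j hp
    rcases lt_or_gt_of_ne hp with hp' | hp'
    · rw [sign_neg hp', sign_eq_neg_one_iff] at hs
      nlinarith [mul_pos_of_neg_of_neg (neg_neg_of_pos ha) hs]
    · rw [sign_pos hp', sign_eq_one_iff] at hs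
      nlinarith [mul_pos ha hs]

/-- Charts that agree at a point agree on the closure of its cell. -/
theorem IsConeChart.eq_of_dominates {k₁ k₂ : E (n + 1) → B} (h₁ : X.IsConeChart k₁)
    (h₂ : X.IsConeChart k₂) {p q : E (n + 1)} (hp : p ≠ 0) (hd : X.Dominates q p)
    (hq : k₁ q = k₂ q) : k₁ p = k₂ p := by
  have hq0 := hd.ne_zero hp
  let r : ℝ → E (n + 1) := fun t => (1 - t) • q + t • p
  have hr : Continuous r := by fun_prop
  have hr0 : ∀ t ∈ Set.Icc (0 : ℝ) 1, r t ≠ 0 := by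
    intro t ht
    rcases ht.2.eq_or_lt with rfl | h1
    · simpa [r] using hp
    · obtain ⟨j, hj⟩ := X.exists_cellFn_ne_zero hp
      have hjq : X.cellFn j q ≠ 0 := by
        intro h0
        have := hd j hj
        rw [h0, sign_zero, eq_comm, sign_eq_zero_iff] at this
        exact hj this
      intro h0
      have := hd.comb_ne_zero hjq (sub_pos.2 h1) ht.1
      rw [show (1 - t) • q + t • p = 0 from h0, map_zero] at this
      exact this rfl
  have hcont : ∀ k, X.IsConeChart k → ContinuousOn (fun t => k (r t)) (Set.Icc 0 1) :=
    fun k hk t ht => (ContinuousAt.comp (hk.continuousAt (hr0 t ht))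
      hr.continuousAt).continuousWithinAt
  have hmain : Set.Icc (0 : ℝ) 1 ⊆ {t | k₁ (r t) = k₂ (r t)} := by
    refine IsClosed.Icc_subset_of_forall_mem_nhdsWithin ?_ ?_ ?_
    · have : IsClosed (Set.Icc (0 : ℝ) 1 ∩ (fun t => dist (k₁ (r t)) (k₂ (r t))) ⁻¹' {0}) :=
        (continuous_dist.comp_continuousOn ((hcont _ h₁).prodMk (hcont _ h₂))).preimage_isClosed_of_isClosed isClosed_Icc
          isClosed_singleton
      convert this using 1
      ext t
      simp [and_comm]
    · simpa [r] using hq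
    · rintro t ⟨ht, ht0, ht1⟩
      have ht' : t ∈ Set.Icc (0 : ℝ) 1 := ⟨ht0, ht1.le⟩
      have hrt := hr0 t ht'
      -- An element of W that moves q also moves r t, by a positive angle. Near t this angle exceeds
      -- the distance between the two charts, which is zero at t.
      have key : ∀ w : X.W, (w : E (n + 1) ≃ₗᵢ[ℝ] E (n + 1)) q ≠ q →
          ∀ᶠ s in 𝓝 t, dist (k₁ (r s)) (k₂ (r s)) <
            angle (r s) ((w : E (n + 1) ≃ₗᵢ[ℝ] E (n + 1)) (r s)) := by
        intro w hw
        have hwt : (w : E (n + 1) ≃ₗᵢ[ℝ] E (n + 1)) (r t) ≠ r t := by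
          rw [Ne, fixed_iff] at hw ⊢
          push Not at hw ⊢
          obtain ⟨i, hi⟩ := hw
          exact ⟨i, hd.comb_ne_zero hi (sub_pos.2 ht1) ht0⟩
        have hw0 : (w : E (n + 1) ≃ₗᵢ[ℝ] E (n + 1)) (r t) ≠ 0 := by simpa using hrt
        have c1 : ContinuousAt (fun s => dist (k₁ (r s)) (k₂ (r s))) t :=
          (ContinuousAt.comp (f := r) (h₁.continuousAt hrt) hr.continuousAt).dist
            (ContinuousAt.comp (f := r) (h₂.continuousAt hrt) hr.continuousAt)
        have c2 : ContinuousAt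
            (fun s => angle (r s) ((w : E (n + 1) ≃ₗᵢ[ℝ] E (n + 1)) (r s))) t :=
          ContinuousAt.comp (f := fun s => (r s, (w : E (n + 1) ≃ₗᵢ[ℝ] E (n + 1)) (r s)))
            (g := fun p : E (n + 1) × E (n + 1) => angle p.1 p.2)
            (continuousAt_angle hrt hw0) (by fun_prop)
        refine c1.eventually_lt c2 ?_
        rw [show k₁ (r t) = k₂ (r t) from ht, dist_self]
        refine lt_of_le_of_ne (angle_nonneg _ _) fun h0 => hwt ?_
        exact (eq_of_angle_eq_zero_of_norm_eq h0.symm (by simp)).symm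
      have key' := eventually_all.2 fun w : X.W => eventually_imp_distrib_left.2 (key w)
      have hnz : ∀ᶠ s in 𝓝 t, r s ≠ 0 := hr.continuousAt.eventually (isOpen_ne.mem_nhds hrt)
      refine mem_nhdsWithin_of_mem_nhds ?_
      filter_upwards [key', hnz] with s hs hs0
      -- In a chart through both points their distance is the angle between r s and w (r s) for some
      -- w in W. The bounds above force w to fix q, hence also p and r s, so the distance is zero.
      obtain ⟨k₃, h₃, x, y, hx, hy, ex, ey⟩ := X.exists_isConeChart_pair (k₁ (r s)) (k₂ (r s))
      have hpos := inv_pos.2 (norm_pos_iff.2 hs0)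
      obtain ⟨w₁, hw₁, H₁⟩ := h₃.exists_mem_W h₁
      obtain ⟨w₂, hw₂, H₂⟩ := h₃.exists_mem_W h₂
      have e1 := H₁ x (‖r s‖⁻¹ • r s) hx (norm_unit hs0) (by rw [ex, h₁.apply_smul hs0 hpos])
      have e2 := H₂ y (‖r s‖⁻¹ • r s) hy (norm_unit hs0) (by rw [ey, h₂.apply_smul hs0 hpos])
      have hd12 : dist (k₁ (r s)) (k₂ (r s)) = angle (r s) ((w₁⁻¹ * w₂) (r s)) := by
        rw [← ex, ← ey, h₃.dist_eq (ne_zero_of_norm_one hx) (ne_zero_of_norm_one hy), e1, e2,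
          map_smul, map_smul, angle_smul_left_of_pos _ _ hpos, angle_smul_right_of_pos _ _ hpos,
          ← LinearIsometry.angle_map w₁.toLinearIsometry (r s)]
        congr 1
        exact (w₁.apply_symm_apply _).symm
      by_cases hwq : (w₁⁻¹ * w₂) q = q
      · have hwp : (w₁⁻¹ * w₂) p = p := by
          let w : X.W := ⟨w₁⁻¹ * w₂, X.W.mul_mem (X.W.inv_mem hw₁) hw₂⟩
          refine (fixed_iff w p).2 fun i => ?_
          by_contra h0
          have := hd _ h0
          rw [(fixed_iff w q).1 hwq i, sign_zero, eq_comm, sign_eq_zero_iff] at this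
          exact h0 this
        have hws : (w₁⁻¹ * w₂) (r s) = r s := by simp only [r, map_add, map_smul, hwq, hwp]
        show k₁ (r s) = k₂ (r s)
        rw [← dist_eq_zero, hd12, hws, angle_self hs0]
      · have := hs ⟨w₁⁻¹ * w₂, X.W.mul_mem (X.W.inv_mem hw₁) hw₂⟩ hwq
        exact absurd hd12 this.ne
  have := hmain (Set.right_mem_Icc.2 zero_le_one)
  simpa [r] using this

/-! ### Changing an apartment while keeping its germ at a point -/

/-- A vector in the complement of all walls. -/
theorem exists_generic (X : SphericalBuilding n B) :
    ∃ e, ∀ j, X.cellFn j ≠ 0 → X.cellFn j e ≠ 0 := by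
  by_contra! h
  -- A real vector space is not a finite union of proper subspaces.
  obtain ⟨j, hj⟩ := Subspace.exists_eq_top_of_iUnion_eq_univ (k := ℝ)
    (p := fun j : {j // X.cellFn j ≠ 0} => LinearMap.ker (X.cellFn j).toLinearMap) (by
      rw [Set.eq_univ_iff_forall]
      intro e
      obtain ⟨j, hj, he⟩ := h e
      exact Set.mem_iUnion.2 ⟨⟨j, hj⟩, he⟩)
  refine j.2 ?_
  ext1 x
  have : x ∈ LinearMap.ker (X.cellFn j).toLinearMap := by rw [hj]; trivial
  exact this

/-- Given an antipode `a` of a point `k p` of an apartment, there is an apartment that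
contains `a` and has the same germ at that point. -/
theorem IsConeChart.exists_antipodal {k : E (n + 1) → B} (hk : X.IsConeChart k) {p : E (n + 1)}
    (hp : p ≠ 0) {a : B} (ha : dist (k p) a = Real.pi) :
    ∃ k', X.IsConeChart k' ∧ k' (-p) = a ∧ ∀ᶠ x in 𝓝 p, k' x = k x := by
  obtain ⟨e, he⟩ := X.exists_generic
  -- The point q = p + s e lies in an open cell with p in its closure, and p is the midpoint of q
  -- and q' = p - s e. The norm bound only serves the case that e is proportional to p.
  obtain ⟨s, hs, hd1, hd2, hsm⟩ : ∃ s : ℝ, 0 < s ∧ X.Dominates (p + s • e) p ∧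
      X.Dominates (p - s • e) p ∧ ‖s • e‖ < ‖p‖ := by
    have t1 : Tendsto (fun s : ℝ => p + s • e) (𝓝[>] 0) (𝓝 p) := by
      have : Continuous fun s : ℝ => p + s • e := by fun_prop
      simpa using (this.tendsto 0).mono_left nhdsWithin_le_nhds
    have t2 : Tendsto (fun s : ℝ => p - s • e) (𝓝[>] 0) (𝓝 p) := by
      have : Continuous fun s : ℝ => p - s • e := by fun_prop
      simpa using (this.tendsto 0).mono_left nhdsWithin_le_nhds
    have t3 : Tendsto (fun s : ℝ => ‖s • e‖) (𝓝[>] 0) (𝓝 0) := by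
      have : Continuous fun s : ℝ => ‖s • e‖ := by fun_prop
      simpa using (this.tendsto 0).mono_left nhdsWithin_le_nhds
    obtain ⟨s, ⟨⟨h1, h2⟩, h3⟩, h4⟩ := (((t1.eventually (X.eventually_dominates p)).and
      (t2.eventually (X.eventually_dominates p))).and
      (t3.eventually (gt_mem_nhds (norm_pos_iff.2 hp)))).and self_mem_nhdsWithin |>.exists
    exact ⟨s, h4, h1, h2, h3⟩
  set q := p + s • e with hq
  set q' := p - s • e with hq'
  have hq0 := hd1.ne_zero hp
  have hq'0 := hd2.ne_zero hp
  have hnq0 := neg_ne_zero.2 hq0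
  have hnp0 := neg_ne_zero.2 hp
  obtain ⟨k₂, h₂, e2, y, hy, ey⟩ := hk.exists_through hq'0 a
  have e2p : k₂ p = k p := h₂.eq_of_dominates hk hp hd2 e2
  have e2a : k₂ (-p) = a := by
    rw [← ey]
    exact h₂.map_neg_eq hp (ne_zero_of_norm_one hy) (by rw [e2p, ey, ha])
  have hqq : q' = (2 : ℝ) • p + (1 : ℝ) • -q := by rw [hq, hq']; module
  -- The arc of k from q to q' and the arc of k₂ from p to -q overlap between p and q'. Together
  -- they form a local geodesic of length π. If p and q' have the same image, then q is a positive
  -- multiple of p.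
  have hdist : dist (k q) (k₂ (-q)) = Real.pi := by
    by_cases hpq : k p = k q'
    · have h0 : angle p q' = 0 := by rw [← hk.dist_eq hp hq'0, hpq, dist_self]
      obtain ⟨-, r, hr, hrp⟩ := angle_eq_zero_iff.1 h0
      have h2 : q = (2 - r) • p := by rw [sub_smul, ← hrp, hq, hq']; module
      have h3 : 0 < 2 - r := by
        by_contra! h3
        have : s • e = (1 - r) • p := by rw [sub_smul, ← hrp, hq']; module
        rw [this, norm_smul] at hsm
        have h4 : (1 : ℝ) ≤ ‖1 - r‖ := by
          rw [Real.norm_eq_abs, abs_of_neg (by linarith)]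
          linarith
        nlinarith [norm_nonneg p]
      rw [h2, hk.apply_smul hp h3, ← smul_neg, h₂.apply_smul hnp0 h3, e2a, ha]
    · have b1 : Between (k q) (k p) (k q') :=
        hk.between hq0 hp hq'0 (a := 1 / 2) (b := 1 / 2) (by norm_num) (by norm_num)
          (by rw [hq, hq']; module)
      have b2 : Between (k p) (k q') (k₂ (-q)) := by
        rw [← e2p, ← e2]
        exact h₂.between hp hq'0 hnq0 zero_le_two zero_le_one hqq
      have hsum : dist (k q) (k q') + dist (k q') (k₂ (-q)) = Real.pi := by
        rw [hk.dist_eq hq0 hq'0, ← e2, h₂.dist_eq hq'0 hnq0, angle_neg_right, angle_comm q' q]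
        ring
      rw [← X.cat1.between_of_between b1 b2 hpq hsum.le, hsum]
  -- A chart from q to its antipode `k₂ (-q)`. Agreement with k at q spreads to a neighbourhood of
  -- q, and agreement with k₂ at -q spreads to -p.
  obtain ⟨k₃, h₃, e3, y', hy', ey'⟩ := hk.exists_through hq0 (k₂ (-q))
  have e3q : k₃ (-q) = k₂ (-q) := by
    rw [← ey']
    exact h₃.map_neg_eq hq0 (ne_zero_of_norm_one hy') (by rw [e3, ey', hdist])
  have e3p : k₃ p = k p := h₃.eq_of_dominates hk hp hd1 e3
  have e3a : k₃ (-p) = a := (h₃.eq_of_dominates h₂ hnp0 hd1.neg e3q).trans e2a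
  have e3q' : k₃ q' = k q' :=
    (h₃.eq_of_comb h₂ hp hq'0 hnq0 (e3p.trans e2p.symm) e3q zero_le_two zero_le_one hqq).trans e2
  refine ⟨k₃, h₃, e3a, ?_⟩
  have hopen : ∀ᶠ y in 𝓝 q, y ≠ 0 ∧ k₃ y = k y := by
    filter_upwards [X.eventually_dominates q, isOpen_ne.mem_nhds hq0] with y hy hy0
    refine ⟨hy0, h₃.eq_of_dominates hk hy0 (fun j hj => ?_) e3⟩
    refine (hy j fun h0 => ?_).symm
    have hj0 : X.cellFn j ≠ 0 := by
      intro h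
      rw [h] at hj
      exact hj rfl
    by_cases hjp : X.cellFn j p = 0
    · rw [hq, map_add, hjp, zero_add, map_smul, smul_eq_mul] at h0
      exact mul_ne_zero hs.ne' (he j hj0) h0
    · have := hd1 j hjp
      rw [h0, sign_zero, eq_comm, sign_eq_zero_iff] at this
      exact hjp this
  have ht : Tendsto (fun x : E (n + 1) => (2 : ℝ) • x - q') (𝓝 p) (𝓝 q) := by
    have : Continuous fun x : E (n + 1) => (2 : ℝ) • x - q' := by fun_prop
    convert this.tendsto p using 2
    rw [hq, hq']
    module
  -- x is the midpoint of q' and of 2x - q', which is close to q when x is close to p; k₃ and k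
  -- agree at both.
  filter_upwards [ht.eventually hopen, isOpen_ne.mem_nhds hp] with x hx hx0
  exact h₃.eq_of_comb hk hx.1 hx0 hq'0 hx.2 e3q' (a := 1 / 2) (b := 1 / 2) (by norm_num)
    (by norm_num) (by module)

end SphericalBuilding

/-! ### Rigidity of spherical sets -/

section spherical

variable {M : Type*} [MetricSpace M]

theorem norm_sphere {d : ℕ} (u : USphere d) : ‖(u : E d)‖ = 1 := by simp

theorem IsSpherical.eq_of_dist_eq_pi {C : Set M} (hC : IsSpherical C) {x y z : M} (hx : x ∈ C)
    (hy : y ∈ C) (hz : z ∈ C) (hxy : dist x y = Real.pi) (hxz : dist x z = Real.pi) : y = z := by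
  obtain ⟨d, f, hf⟩ := hC
  have h1 : angle (f ⟨x, hx⟩ : E (d + 1)) (f ⟨y, hy⟩) = Real.pi := (hf _ _).trans hxy
  have h2 : angle (f ⟨x, hx⟩ : E (d + 1)) (f ⟨z, hz⟩) = Real.pi := (hf _ _).trans hxz
  have key : ∀ u : USphere (d + 1), angle (f ⟨x, hx⟩ : E (d + 1)) u = Real.pi →
      (u : E (d + 1)) = -(f ⟨x, hx⟩ : E (d + 1)) := by
    intro u hu
    refine (eq_of_angle_eq_zero_of_norm_eq ?_ (by simp)).symm
    rw [angle_neg_left, hu, sub_self]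
  have h3 : f ⟨y, hy⟩ = f ⟨z, hz⟩ := Subtype.ext ((key _ h1).trans (key _ h2).symm)
  have h4 := hf ⟨y, hy⟩ ⟨z, hz⟩
  rw [h3, angDist, angle_self (ne_zero_of_norm_one (norm_sphere _))] at h4
  exact dist_eq_zero.1 h4.symm

/-- In a spherical set, the distance from the end of a geodesic is determined by the distances
from two other points of that geodesic. -/
theorem IsSpherical.dist_eq_angle {V : Type*} [NormedAddCommGroup V] [InnerProductSpace ℝ V]
    {C : Set M} (hC : IsSpherical C) {x m y z : V} (hx : x ≠ 0) (hm : m ≠ 0) (hy : y ≠ 0)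
    (hz : z ≠ 0) {x' m' y' z' : M} (hx' : x' ∈ C) (hm' : m' ∈ C) (hy' : y' ∈ C) (hz' : z' ∈ C)
    (hxm : dist x' m' = angle x m) (hmy : dist m' y' = angle m y) (hxy : dist x' y' = angle x y)
    (hxz : dist x' z' = angle x z) (hmz : dist m' z' = angle m z)
    (hadd : angle x y = angle x m + angle m y) (h0 : 0 < angle x m) (hpi : angle x m < Real.pi) :
    dist z' y' = angle z y := by
  obtain ⟨d, f, hf⟩ := hC
  replace hf : ∀ a b : C, angle (f a : E (d + 1)) (f b) = dist a b := hf
  have hs : 0 < Real.sin (angle x m) := Real.sin_pos_of_pos_of_lt_pi h0 hpi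
  -- The same linear relation expresses y through x and m in V and in the sphere that models C.
  -- Pairing it with z determines the cosine of the distance from z to y on both sides.
  have k1 := sin_smul_of_angle_add (x := NormedSpace.normalize x) (m := NormedSpace.normalize m)
    (y := NormedSpace.normalize y) (α := angle x m) (β := angle m y) (by simpa using hx)
    (by simpa using hm) (by simpa using hy) (by simp) (by simp) (by simpa using hadd)
  have k2 := sin_smul_of_angle_add (norm_sphere (f ⟨x', hx'⟩)) (norm_sphere (f ⟨m', hm'⟩))
    (norm_sphere (f ⟨y', hy'⟩)) (α := angle x m) (β := angle m y) ((hf _ _).trans hxm)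
    ((hf _ _).trans hmy) (((hf _ _).trans hxy).trans hadd)
  have n1 := congrArg (fun v => ⟪NormedSpace.normalize z, v⟫) k1
  have n2 := congrArg (fun v => ⟪(f ⟨z', hz'⟩ : E (d + 1)), v⟫) k2
  simp only [inner_sub_right, real_inner_smul_right] at n1 n2
  have u1 : ∀ {v : V}, v ≠ 0 → ‖NormedSpace.normalize v‖ = 1 := by simp
  rw [inner_eq_cos_angle_of_norm_eq_one (u1 hz) (u1 hx),
    inner_eq_cos_angle_of_norm_eq_one (u1 hz) (u1 hm),
    inner_eq_cos_angle_of_norm_eq_one (u1 hz) (u1 hy)] at n1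
  rw [inner_eq_cos_angle_of_norm_eq_one (norm_sphere _) (norm_sphere _),
    inner_eq_cos_angle_of_norm_eq_one (norm_sphere _) (norm_sphere _),
    inner_eq_cos_angle_of_norm_eq_one (norm_sphere _) (norm_sphere _), hf, hf, hf] at n2
  simp only [angle_normalize_left, angle_normalize_right, Subtype.dist_eq] at n1 n2
  rw [dist_comm z' m', dist_comm z' x', hxz, hmz, angle_comm m z, angle_comm x z, ← n1] at n2
  have hle : dist z' y' ≤ Real.pi := by
    have := hf ⟨z', hz'⟩ ⟨y', hy'⟩
    rw [Subtype.dist_eq] at this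
    rw [← this]
    exact angle_le_pi _ _
  exact Real.injOn_cos ⟨dist_nonneg, hle⟩ ⟨angle_nonneg _ _, angle_le_pi _ _⟩
    (mul_left_cancel₀ hs.ne' n2)

end spherical

/-! ### Convex spherical sets lie in apartments -/

namespace SphericalBuilding

variable {n : ℕ} {B : Type*} [MetricSpace B] {X : SphericalBuilding n B}

/-- Enlarging the part of a convex spherical set that lies in an apartment. -/
theorem IsConeChart.exists_extension {C : Set B} (hsph : IsSpherical C)
    {k k₂ : E (n + 1) → B} (hk : X.IsConeChart k) (h₂ : X.IsConeChart k₂) {u y : E (n + 1)}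
    (hu : u ≠ 0) (hy : y ≠ 0) (hku : k u = k₂ u) (hyC : k₂ y ∈ C) (huC : k u ∈ C)
    (hyk : ∀ x ≠ 0, k x ≠ k₂ y) {t : ℝ} (ht0 : 0 < t) (ht1 : t < 1)
    (hm : (1 - t) • u + t • y ≠ 0)
    (hkm : k ((1 - t) • u + t • y) = k₂ ((1 - t) • u + t • y))
    (hmC : k ((1 - t) • u + t • y) ∈ C) (hlt : angle u y < Real.pi) :
    ∃ k', X.IsConeChart k' ∧ k' y = k₂ y ∧ ∀ z ≠ 0, k z ∈ C → k' z = k z := by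
  set m := (1 - t) • u + t • y with hmd
  have ht1' : 0 < 1 - t := sub_pos.2 ht1
  have hny := neg_ne_zero.2 hy
  have hadd : angle u y = angle u m + angle m y := angle_add_of_comb hm ht1'.le ht0.le hmd
  have hpos : 0 < angle u m := by
    refine lt_of_le_of_ne (angle_nonneg _ _) fun h => ?_
    obtain ⟨-, r, hr, hrm⟩ := angle_eq_zero_iff.1 h.symm
    have e : y = ((r - (1 - t)) / t) • u := by
      have : t • y = (r - (1 - t)) • u := by rw [sub_smul, ← hrm, hmd]; abel
      rw [div_eq_inv_mul, mul_smul, ← this, smul_smul, inv_mul_cancel₀ ht0.ne', one_smul]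
    rcases lt_trichotomy ((r - (1 - t)) / t) 0 with hn | h0 | hp
    · exact hlt.ne (angle_eq_pi_iff.2 ⟨hu, _, hn, e⟩)
    · rw [h0, zero_smul] at e
      exact hy e
    · exact hyk u hu (by rw [hku, e, h₂.apply_smul hu hp])
  have hmy : dist (k m) (k₂ y) = angle m y := by rw [hkm, h₂.dist_eq hm hy]
  -- The arc of k from -y over u to m and the arc of k₂ from u over m to y overlap from u to m,
  -- giving a local geodesic of length π.
  have hpi : dist (k (-y)) (k₂ y) = Real.pi := by
    have b1 : Between (k (-y)) (k u) (k m) := by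
      refine hk.between hny hu hm (a := t / (1 - t)) (b := 1 / (1 - t)) (by positivity)
        (by positivity) ?_
      rw [hmd, smul_add, smul_smul, smul_smul, one_div_mul_cancel ht1'.ne', one_smul, smul_neg,
        one_div_mul_eq_div]
      abel
    have b2 : Between (k u) (k m) (k₂ y) := by
      rw [hku, hkm]
      exact h₂.between hu hm hy ht1'.le ht0.le hmd
    have hsum : dist (k (-y)) (k m) + dist (k m) (k₂ y) = Real.pi := by
      rw [hk.dist_eq hny hm, hmy, angle_neg_left, angle_comm y m]
      ring
    rw [← X.cat1.between_of_between b1 b2 (fun h => hpos.ne' (by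
      rw [← hk.dist_eq hu hm, h, dist_self])) hsum.le, hsum]
  obtain ⟨k', h', ey, hev⟩ := hk.exists_antipodal hny hpi
  rw [neg_neg] at ey
  refine ⟨k', h', ey, fun z hz hzC => ?_⟩
  have hd : dist (k z) (k₂ y) = angle z y :=
    hsph.dist_eq_angle hu hm hy hz huC hmC hyC hzC (hk.dist_eq hu hm) hmy
      (by rw [hku, h₂.dist_eq hu hy]) (hk.dist_eq hu hz) (hk.dist_eq hm hz) hadd hpos
      (by linarith [angle_nonneg m y])
  rcases (angle_le_pi y z).eq_or_lt with h | h
  · obtain ⟨-, r, hr, rfl⟩ := angle_eq_pi_iff.1 h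
    have : r • y = (-r) • (-y) := by simp
    rw [this, h'.apply_smul hny (neg_pos.2 hr), hk.apply_smul hny (neg_pos.2 hr)]
    exact hev.self_of_nhds
  -- A point x near -y, towards z, where k and k' still agree. By the distance formula for C, both k
  -- z and k' z are the point of the geodesic from k x to k₂ y at distance `angle x z` from k x.
  · obtain ⟨s, hs, hs0, hse⟩ : ∃ s : ℝ, 0 < s ∧ -y + s • z ≠ 0 ∧
        k' (-y + s • z) = k (-y + s • z) := by
      have t1 : Tendsto (fun s : ℝ => -y + s • z) (𝓝[>] 0) (𝓝 (-y)) := by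
        have : Continuous fun s : ℝ => -y + s • z := by fun_prop
        simpa using (this.tendsto 0).mono_left nhdsWithin_le_nhds
      obtain ⟨s, ⟨h1, h2⟩, h3⟩ := ((t1.eventually hev).and
        (t1.eventually (isOpen_ne.mem_nhds hny))).and self_mem_nhdsWithin |>.exists
      exact ⟨s, h3, h2, h1⟩
    set x := -y + s • z with hxd
    have hz' : z = (1 / s) • x + (1 / s) • y := by
      rw [← smul_add, hxd, neg_add_cancel_comm, smul_smul, one_div_mul_cancel hs.ne', one_smul]
    have hxy : dist (k x) (k₂ y) = angle x y := by rw [← hse, ← ey, h'.dist_eq hs0 hy]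
    have hxlt : angle x y < Real.pi := by
      refine lt_of_le_of_ne (angle_le_pi _ _) fun hx => ?_
      rw [angle_comm] at hx
      obtain ⟨-, r, hr, hrx⟩ := angle_eq_pi_iff.1 hx
      have e : z = ((1 / s) * (r + 1)) • y := by
        rw [mul_smul, add_smul, one_smul, ← hrx, smul_add]
        exact hz'
      rcases lt_trichotomy ((1 / s) * (r + 1)) 0 with hn | h0 | hp
      · exact h.ne (angle_eq_pi_iff.2 ⟨hy, _, hn, e⟩)
      · rw [h0, zero_smul] at e
        exact hz e
      · refine hyk z hz (dist_eq_zero.1 ?_)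
        rw [hd, e, angle_smul_left_of_pos _ _ hp, angle_self hy]
    have hs' : 0 ≤ 1 / s := by positivity
    refine X.cat1.eq_of_between (p := k x) (q := k₂ y) (by rwa [hxy]) ?_ ?_ ?_
    · rw [← hse, ← ey]
      exact h'.between hs0 hz hy hs' hs' hz'
    · unfold Between
      rw [hxy, hd, hk.dist_eq hs0 hz, angle_add_of_comb hz hs' hs' hz']
    · rw [hk.dist_eq hs0 hz, ← hse, h'.dist_eq hs0 hz]

/-- The walls that contain `x`. -/
def zeroSet (X : SphericalBuilding n B) (x : E (n + 1)) : Set (Option X.W × Fin (n + 1)) :=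
  {j | X.cellFn j x = 0}

/-- A point of a convex set in the fewest possible walls: near it, the set lies in one cell. -/
theorem exists_generic_point (X : SphericalBuilding n B) {C : Set B} (hconv : IsConvex C)
    (hne : C.Nonempty) :
    ∃ k₀ u, X.IsConeChart k₀ ∧ u ≠ 0 ∧ k₀ u ∈ C ∧
      ∀ k k₂, X.IsConeChart k → X.IsConeChart k₂ → k u = k₀ u → k₂ u = k₀ u →
        ∀ y ≠ 0, k₂ y ∈ C → angle u y < Real.pi →
          ∃ t : ℝ, 0 < t ∧ t < 1 ∧ (1 - t) • u + t • y ≠ 0 ∧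
            k ((1 - t) • u + t • y) = k₂ ((1 - t) • u + t • y) ∧
            k ((1 - t) • u + t • y) ∈ C := by
  let S : Set ((E (n + 1) → B) × E (n + 1)) := {p | X.IsConeChart p.1 ∧ p.2 ≠ 0 ∧ p.1 p.2 ∈ C}
  have hS : S.Nonempty := by
    obtain ⟨c, hc⟩ := hne
    obtain ⟨k, hk, x, y, hx, hy, rfl, -⟩ := X.exists_isConeChart_pair c c
    exact ⟨(k, x), hk, ne_zero_of_norm_one hx, hc⟩
  obtain ⟨⟨k₀, u⟩, ⟨hk₀, hu, huC⟩, hmin⟩ :=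
    (measure fun p : (E (n + 1) → B) × E (n + 1) => (X.zeroSet p.2).ncard).wf.has_min S hS
  refine ⟨k₀, u, hk₀, hu, huC, fun k k₂ hk h₂ hku hku2 y hy hyC hlt => ?_⟩
  have t1 : Tendsto (fun s : ℝ => (1 - s) • u + s • y) (𝓝[>] 0) (𝓝 u) := by
    have : Continuous fun s : ℝ => (1 - s) • u + s • y := by fun_prop
    simpa using (this.tendsto 0).mono_left nhdsWithin_le_nhds
  obtain ⟨t, hd, ht0, ht1⟩ := ((t1.eventually (X.eventually_dominates u)).and
    (Ioo_mem_nhdsGT one_pos)).exists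
  have hm := hd.ne_zero hu
  have hmC : k₂ ((1 - t) • u + t • y) ∈ C :=
    hconv _ (by rw [hku2]; exact huC) _ hyC (by rwa [h₂.dist_eq hu hy]) _
      (h₂.between hu hm hy (sub_pos.2 ht1).le ht0.le rfl)
  set m := (1 - t) • u + t • y
  have hsub : X.zeroSet m ⊆ X.zeroSet u := by
    intro j (hj : X.cellFn j m = 0)
    by_contra h0
    have := hd j h0
    rw [hj, sign_zero, eq_comm, sign_eq_zero_iff] at this
    exact h0 this
  -- Moving slightly off u can only leave walls, and by minimality none is left. So m is in the cell
  -- of u, and charts that agree at u agree at m.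
  have heq : X.zeroSet m = X.zeroSet u :=
    Set.eq_of_subset_of_ncard_le hsub (not_lt.1 (hmin (k₂, m) ⟨h₂, hm, hmC⟩)) (Set.toFinite _)
  have hd' : X.Dominates u m := by
    intro j hj
    refine (hd j fun h0 => hj ?_).symm
    have : j ∈ X.zeroSet m := by rw [heq]; exact h0
    exact this
  have hkm := hk.eq_of_dominates h₂ hm hd' (hku.trans hku2.symm)
  exact ⟨t, ht0, ht1, hm, hkm, by rw [hkm]; exact hmC⟩

/-- A convex spherical subset of a spherical building lies in an apartment. -/
theorem exists_isConeChart_superset (X : SphericalBuilding n B) {C : Set B} (hconv : IsConvex C)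
    (hsph : IsSpherical C) (hne : C.Nonempty) :
    ∃ k, X.IsConeChart k ∧ ∀ c ∈ C, ∃ x ≠ 0, k x = c := by
  obtain ⟨k₀, u, hk₀, hu, huC, hgen⟩ := X.exists_generic_point hconv hne
  -- An antipode of the base point in C, unique if it exists, is required from the start, since
  -- extension works only along segments shorter than π.
  let S : Set (E (n + 1) → B) := {k | X.IsConeChart k ∧ k u = k₀ u ∧
    ∀ y ∈ C, dist (k₀ u) y = Real.pi → k (-u) = y}
  have hS : S.Nonempty := by
    by_cases h : ∃ y ∈ C, dist (k₀ u) y = Real.pi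
    · obtain ⟨y, hyC, hy⟩ := h
      obtain ⟨k, hk, hku, x, hx, hkx⟩ := hk₀.exists_through hu y
      refine ⟨k, hk, hku, fun z hzC hz => ?_⟩
      rw [← hsph.eq_of_dist_eq_pi huC hyC hzC hy hz, ← hkx]
      exact hk.map_neg_eq hu (ne_zero_of_norm_one hx) (by rw [hku, hkx, hy])
    · push Not at h
      exact ⟨k₀, hk₀, rfl, fun y hyC hy => absurd hy (h y hyC)⟩
  let sg : E (n + 1) → Option X.W × Fin (n + 1) → SignType :=
    fun x j => SignType.sign (X.cellFn j x)
  let T : (E (n + 1) → B) → Set (Option X.W × Fin (n + 1) → SignType) :=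
    fun k => sg '' {x | x ≠ 0 ∧ k x ∈ C}
  -- The covered part of C is measured by the sign vectors of its points, of which there are
  -- finitely many.
  obtain ⟨-, ⟨k, ⟨hk, hku, hkn⟩, rfl⟩, hmax⟩ := (T '' S).toFinite.exists_maximal (hS.image T)
  refine ⟨k, hk, ?_⟩
  by_contra! h
  obtain ⟨y, hyC, hyk⟩ := h
  have hlt : dist (k₀ u) y < Real.pi :=
    lt_of_le_of_ne (X.dist_le_pi _ _) fun h => hyk (-u) (neg_ne_zero.2 hu) (hkn y hyC h)
  obtain ⟨k₂, h₂, hku2, v, hv, rfl⟩ := hk₀.exists_through hu y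
  have hv0 := ne_zero_of_norm_one hv
  rw [← hku2, h₂.dist_eq hu hv0] at hlt
  obtain ⟨t, ht0, ht1, hm, hkm, hmC⟩ := hgen k k₂ hk h₂ hku hku2 v hv0 hyC hlt
  obtain ⟨k', h', hkv, hext⟩ := hk.exists_extension hsph h₂ hu hv0 (hku.trans hku2.symm) hyC
    (by rwa [hku]) hyk ht0 ht1 hm hkm hmC hlt
  have hS' : k' ∈ S := by
    refine ⟨h', by rw [hext u hu (by rwa [hku]), hku], fun z hzC hz => ?_⟩
    have := hkn z hzC hz
    rw [hext (-u) (neg_ne_zero.2 hu) (by rwa [this]), this]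
  have hsub : T k ⊆ T k' := by
    rintro _ ⟨x, ⟨hx, hxC⟩, rfl⟩
    exact ⟨x, ⟨hx, by rwa [hext x hx hxC]⟩, rfl⟩
  -- By maximality the cell of v already contains a covered point z of C. Then k and k' agree at z,
  -- hence at v, although k misses `k₂ v`.
  obtain ⟨z, ⟨hz, hzC⟩, hsz⟩ := hmax ⟨k', hS', rfl⟩ hsub ⟨v, ⟨hv0, by rwa [hkv]⟩, rfl⟩
  refine hyk v hv0 ?_
  rw [← hkv]
  exact hk.eq_of_dominates h' hv0 (fun j _ => congrFun hsz j) (hext z hz hzC).symm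

end SphericalBuilding

/-! ### The infinitesimal law of cosines -/

theorem mul_sinc (y : ℝ) : y * Real.sinc y = Real.sin y := by
  by_cases h : y = 0
  · simp [h]
  · rw [Real.sinc_of_ne_zero h, mul_div_cancel₀ _ h]

/-- Infinitesimally, the spherical law of cosines is the Euclidean one. -/
theorem tendsto_comparison_cos {c : ℝ} {d : ℝ × ℝ → ℝ} {l : Filter (ℝ × ℝ)}
    (h1 : Tendsto Prod.fst l (𝓝 0)) (h2 : Tendsto Prod.snd l (𝓝 0)) (hd : Tendsto d l (𝓝 0))
    (hpos : ∀ᶠ p in l, 0 < p.1 ∧ 0 < p.2)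
    (hcos : ∀ᶠ p in l, Real.cos (d p)
      = Real.cos p.1 * Real.cos p.2 + Real.sin p.1 * Real.sin p.2 * c) :
    Tendsto (fun p => (p.1 ^ 2 + p.2 ^ 2 - d p ^ 2) / (2 * p.1 * p.2)) l (𝓝 c) := by
  have hsinc : ∀ {f : ℝ × ℝ → ℝ}, Tendsto f l (𝓝 0) →
      Tendsto (fun p => Real.sinc (f p)) l (𝓝 1) := by
    intro f hf
    have := (Real.continuous_sinc.tendsto 0).comp hf
    rwa [Real.sinc_zero] at this
  have hp : Tendsto (fun p => (d p + (p.1 - p.2)) / 2) l (𝓝 0) := by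
    simpa using (hd.add (h1.sub h2)).div_const 2
  have hm : Tendsto (fun p => (d p - (p.1 - p.2)) / 2) l (𝓝 0) := by
    simpa using (hd.sub (h1.sub h2)).div_const 2
  have hden := (hsinc hp).mul (hsinc hm)
  have hlim : Tendsto (fun p => 1 - (1 - c) * ((Real.sinc p.1 * Real.sinc p.2) /
      (Real.sinc ((d p + (p.1 - p.2)) / 2) * Real.sinc ((d p - (p.1 - p.2)) / 2)))) l (𝓝 c) := by
    have := (((hsinc h1).mul (hsinc h2)).div hden (by norm_num)).const_mul (1 - c)
    simpa using this.const_sub 1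
  refine hlim.congr' ?_
  have hne := hden.eventually (isOpen_ne.mem_nhds (show (1 : ℝ) * 1 ≠ 0 by norm_num))
  filter_upwards [hpos, hcos, hne] with p ⟨hs, ht⟩ hc hn
  set s := p.1
  set t := p.2
  set δ := d p
  -- The product formula for cos δ - cos (s - t), written with `sinc`: it shows δ² - (s - t)² as 2 s
  -- t (1 - c) times a factor tending to 1.
  have key : (δ ^ 2 - (s - t) ^ 2) *
      (Real.sinc ((δ + (s - t)) / 2) * Real.sinc ((δ - (s - t)) / 2))
      = 2 * s * t * (Real.sinc s * Real.sinc t) * (1 - c) := by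
    have e1 := mul_sinc ((δ + (s - t)) / 2)
    have e2 := mul_sinc ((δ - (s - t)) / 2)
    have e3 := mul_sinc s
    have e4 := mul_sinc t
    have e5 : Real.cos δ - Real.cos (s - t)
        = -2 * Real.sin ((δ + (s - t)) / 2) * Real.sin ((δ - (s - t)) / 2) :=
      Real.cos_sub_cos _ _
    rw [hc, Real.cos_sub, ← e1, ← e2, ← e3, ← e4] at e5
    linear_combination 2 * e5
  rw [eq_div_iff (by positivity)]
  have hn' := mul_ne_zero_iff.1 hn
  have h1' := hn'.1
  have h2' := hn'.2
  field_simp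
  linear_combination key

theorem inner_eq_of_angle_eq {V V' : Type*} [NormedAddCommGroup V] [InnerProductSpace ℝ V]
    [NormedAddCommGroup V'] [InnerProductSpace ℝ V'] {a b : V} {a' b' : V'} (ha : ‖a‖ = 1)
    (hb : ‖b‖ = 1) (ha' : ‖a'‖ = 1) (hb' : ‖b'‖ = 1) (h : angle a b = angle a' b') :
    ⟪a, b⟫ = ⟪a', b'⟫ := by
  rw [inner_eq_cos_angle_of_norm_eq_one ha hb, inner_eq_cos_angle_of_norm_eq_one ha' hb', h]

theorem angle_eq_arccos {V : Type*} [NormedAddCommGroup V] [InnerProductSpace ℝ V] {a b : V}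
    (ha : ‖a‖ = 1) (hb : ‖b‖ = 1) : angle a b = Real.arccos ⟪a, b⟫ := by
  rw [angle, ha, hb]
  simp

/-! ### Isometrically embedded spheres -/

theorem IsSphereEmbedding.isSpherical {M : Type*} [MetricSpace M] {n : ℕ}
    {F : USphere (n + 1) → M} (hF : IsSphereEmbedding F) : IsSpherical (Set.range F) := by
  refine ⟨n, fun a => a.2.choose, fun a b => ?_⟩
  rw [← hF, a.2.choose_spec, b.2.choose_spec]
  rfl

/-- A great circle arc maps to a geodesic, and geodesics shorter than π are unique. -/
theorem IsSphereEmbedding.isConvex {M : Type*} [MetricSpace M] (hM : IsCAT1 M) {n : ℕ}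
    {F : USphere (n + 1) → M} (hF : IsSphereEmbedding F) : IsConvex (Set.range F) := by
  rintro _ ⟨v, rfl⟩ _ ⟨w, rfl⟩ hlt m hm
  have hd := hF v w
  unfold angDist at hd
  rcases (angle_nonneg (v : E (n + 1)) w).eq_or_lt with h0 | h0
  · refine ⟨v, ?_⟩
    unfold Between at hm
    rw [hd, ← h0] at hm
    exact dist_le_zero.1 (by linarith [dist_nonneg (x := m) (y := F w)])
  · obtain ⟨e, he, hve, hw⟩ := exists_circ (norm_sphere v) (norm_sphere w) h0 (by rwa [← hd])
    rw [← hd] at hw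
    have hs : dist (F v) m ≤ dist (F v) (F w) := by
      unfold Between at hm
      linarith [dist_nonneg (x := m) (y := F w)]
    have h0' : 0 ≤ dist (F v) m := dist_nonneg
    have hc := norm_circ (norm_sphere v) he hve (dist (F v) m)
    have a1 : dist (F v) (F (toSphere _ hc)) = dist (F v) m := by
      rw [hF]
      have := angle_circ (norm_sphere v) he hve (s := 0) (t := dist (F v) m)
        (by rw [zero_sub, abs_neg, abs_of_nonneg h0']; linarith)
      rwa [circ_zero, zero_sub, abs_neg, abs_of_nonneg h0'] at this
    have a2 : dist (F (toSphere _ hc)) (F w) = dist (F v) (F w) - dist (F v) m := by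
      rw [hF]
      have habs : |dist (F v) m - dist (F v) (F w)| = dist (F v) (F w) - dist (F v) m := by
        rw [abs_sub_comm, abs_of_nonneg (by linarith)]
      have := angle_circ (norm_sphere v) he hve (s := dist (F v) m) (t := dist (F v) (F w))
        (by rw [habs]; linarith)
      rw [habs, ← hw] at this
      exact this
    exact ⟨toSphere _ hc, hM.eq_of_between hlt (by unfold Between; linarith) hm a1⟩

/-- Inner products are preserved, so the standard basis goes to an orthonormal basis b, and w is the
image of its own vector of b-coordinates. -/
theorem surjective_of_angDist {d : ℕ} {h : USphere d → USphere d}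
    (hh : ∀ u v, angDist (h u) (h v) = angDist u v) : Function.Surjective h := by
  have hin : ∀ u v, ⟪(h u : E d), h v⟫ = ⟪(u : E d), (v : E d)⟫ := fun u v =>
    inner_eq_of_angle_eq (norm_sphere _) (norm_sphere _) (norm_sphere _) (norm_sphere _) (hh u v)
  let s : Fin d → USphere d := fun i => toSphere (EuclideanSpace.single i 1) (by simp)
  have hs : ∀ i (v : USphere d), ⟪(s i : E d), (v : E d)⟫ = (v : E d) i := by
    intro i v
    simp [s, toSphere, EuclideanSpace.inner_single_left]
  have ho : Orthonormal ℝ (Set.univ.domRestrict fun i => (h (s i) : E d)) := by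
    constructor
    · rintro ⟨i, -⟩
      exact norm_sphere _
    · rintro ⟨i, hi⟩ ⟨j, hj⟩ hij
      have : i ≠ j := fun h => hij (Subtype.ext h)
      simp only [Set.domRestrict_apply]
      rw [hin, hs]
      simp [s, toSphere, this]
  obtain ⟨b, hb⟩ := ho.exists_orthonormalBasis_extension_of_card_eq (by simp)
  intro w
  have hn : ‖b.repr w‖ = 1 := by rw [LinearIsometryEquiv.norm_map, norm_sphere]
  refine ⟨toSphere _ hn, Subtype.ext (b.repr.injective ?_)⟩
  ext i
  rw [b.repr_apply_apply, hb i trivial, hin, hs]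
  rfl

/-! ### Geodesics, angles and rays from a point to an antipode -/

namespace SphericalBuilding

variable {n : ℕ} {B : Type*} [MetricSpace B] {X : SphericalBuilding n B}

theorem IsConeChart.dist_circ {k : E (n + 1) → B} (hk : X.IsConeChart k) {u e : E (n + 1)}
    (hu : ‖u‖ = 1) (he : ‖e‖ = 1) (hue : ⟪u, e⟫ = 0) {s t : ℝ} (h : |s - t| ≤ Real.pi) :
    dist (k (circ u e s)) (k (circ u e t)) = |s - t| := by
  rw [hk.dist_eq (ne_zero_of_norm_one (norm_circ hu he hue _))
    (ne_zero_of_norm_one (norm_circ hu he hue _)), angle_circ hu he hue h]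

/-- A chart that contains an end of a geodesic contains the geodesic. -/
theorem IsConeChart.exists_eq_circ {k : E (n + 1) → B} (hk : X.IsConeChart k) {u : E (n + 1)}
    (hu : ‖u‖ = 1) {x : B} (hkx : k u = x) (c : GeodesicFrom x) {ε : ℝ} (h0 : 0 < ε)
    (hε : ε ≤ c.length) (hpi : ε < Real.pi) {y : E (n + 1)} (hy : ‖y‖ = 1)
    (hky : k y = c.toFun ε) :
    ∃ e, ‖e‖ = 1 ∧ ⟪u, e⟫ = 0 ∧ ∀ t ∈ Set.Icc 0 ε, c.toFun t = k (circ u e t) := by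
  have hang : angle u y = ε := by
    rw [← hk.dist_eq (ne_zero_of_norm_one hu) (ne_zero_of_norm_one hy), hkx, hky,
      dist_start c h0.le hε]
  obtain ⟨e, he, hue, hye⟩ := exists_circ hu hy (by rwa [hang]) (by rwa [hang])
  rw [hang] at hye
  refine ⟨e, he, hue, fun t ht => ?_⟩
  have d1 := dist_start c ht.1 (ht.2.trans hε)
  have d2 := dist_start c h0.le hε
  have d3 := c.isometric t ⟨ht.1, ht.2.trans hε⟩ ε ⟨h0.le, hε⟩
  have habs : |t - ε| = ε - t := by rw [abs_sub_comm, abs_of_nonneg (by linarith [ht.2])]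
  have habs' : |0 - t| = t := by rw [zero_sub, abs_neg, abs_of_nonneg ht.1]
  have d4 : dist x (k (circ u e t)) = t := by
    have := hk.dist_circ hu he hue (s := 0) (t := t) (by rw [habs']; linarith [ht.2])
    rwa [circ_zero, hkx, habs'] at this
  have d5 : dist (k (circ u e t)) (c.toFun ε) = ε - t := by
    have := hk.dist_circ hu he hue (s := t) (t := ε) (by rw [habs]; linarith [ht.1])
    rwa [← hye, hky, habs] at this
  refine X.cat1.eq_of_between (p := x) (q := c.toFun ε) (by rwa [d2]) ?_ ?_ (d1.trans d4.symm)
  · unfold Between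
    rw [d1, d2, d3, habs]
    ring
  · unfold Between
    rw [d4, d5, d2]
    ring

theorem eventually_of_Icc {P : ℝ → Prop} {ε : ℝ} (h0 : 0 < ε) (h : ∀ t ∈ Set.Icc 0 ε, P t) :
    ∀ᶠ t in 𝓝[≥] (0 : ℝ), P t := by
  filter_upwards [Icc_mem_nhdsGE h0] with t ht using h t ht

theorem tendsto_circ (u e : E (n + 1)) : Tendsto (circ u e) (𝓝[≥] 0) (𝓝 u) := by
  have : Continuous (circ u e) := by unfold circ; fun_prop
  simpa using (this.tendsto 0).mono_left nhdsWithin_le_nhds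

/-- Two geodesics with a common starting point initially run in a common apartment. -/
theorem IsConeChart.exists_common {k₀ : E (n + 1) → B} (hk₀ : X.IsConeChart k₀)
    {u : E (n + 1)} (hu : ‖u‖ = 1) {x : B} (hkx : k₀ u = x) (c₁ c₂ : GeodesicFrom x) :
    ∃ k e₁ e₂, X.IsConeChart k ∧ k u = x ∧ ‖e₁‖ = 1 ∧ ⟪u, e₁⟫ = 0 ∧ ‖e₂‖ = 1 ∧ ⟪u, e₂⟫ = 0 ∧
      (∀ᶠ t in 𝓝[≥] (0 : ℝ), c₁.toFun t = k (circ u e₁ t)) ∧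
      ∀ᶠ t in 𝓝[≥] (0 : ℝ), c₂.toFun t = k (circ u e₂ t) := by
  have hu0 := ne_zero_of_norm_one hu
  have hε : ∀ c : GeodesicFrom x, 0 < min c.length 1 := fun c => lt_min c.length_pos one_pos
  have hpi : ∀ c : GeodesicFrom x, min c.length 1 < Real.pi := fun c =>
    (min_le_right _ _).trans_lt (by linarith [Real.pi_gt_three])
  obtain ⟨k₁, h₁, e₁, y₁, hy₁, hky₁⟩ := hk₀.exists_through hu0 (c₁.toFun (min c₁.length 1))
  rw [hkx] at e₁
  obtain ⟨e, he, hue, hce⟩ := h₁.exists_eq_circ hu e₁ c₁ (hε c₁) (min_le_left _ _) (hpi c₁)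
    hy₁ hky₁
  -- A point of c₁ so close to x that its closed cell contains x. A chart through it then contains
  -- x, and with it the start of c₁.
  obtain ⟨t, hd, ht0, ht1⟩ := ((((tendsto_circ u e).mono_left
    (nhdsWithin_mono _ Set.Ioi_subset_Ici_self)).eventually (X.eventually_dominates u)).and
    (Ioo_mem_nhdsGT (hε c₁))).exists
  have hq := norm_circ hu he hue t
  obtain ⟨k, hk, hkq, y₂, hy₂, hky₂⟩ := h₁.exists_through (ne_zero_of_norm_one hq)
    (c₂.toFun (min c₂.length 1))
  have hku : k u = x := by rw [hk.eq_of_dominates h₁ hu0 hd hkq, e₁]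
  obtain ⟨f₁, hf₁, huf₁, H₁⟩ := hk.exists_eq_circ hu hku c₁ ht0
    (ht1.le.trans (min_le_left _ _)) (ht1.trans (hpi c₁)) hq
    (by rw [hkq, hce t ⟨ht0.le, ht1.le⟩])
  obtain ⟨f₂, hf₂, huf₂, H₂⟩ := hk.exists_eq_circ hu hku c₂ (hε c₂) (min_le_left _ _) (hpi c₂)
    hy₂ hky₂
  exact ⟨k, f₁, f₂, hk, hku, hf₁, huf₁, hf₂, huf₂, eventually_of_Icc ht0 H₁,
    eventually_of_Icc (hε c₂) H₂⟩

/-- Angles of geodesics in an apartment are angles in the sphere. -/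
theorem IsConeChart.gAngle_eq {k : E (n + 1) → B} (hk : X.IsConeChart k) {u e e' : E (n + 1)}
    (hu : ‖u‖ = 1) {x : B} (he : ‖e‖ = 1) (hue : ⟪u, e⟫ = 0) (he' : ‖e'‖ = 1)
    (hue' : ⟪u, e'⟫ = 0) {c c' : GeodesicFrom x}
    (hc : ∀ᶠ t in 𝓝[≥] (0 : ℝ), c.toFun t = k (circ u e t))
    (hc' : ∀ᶠ t in 𝓝[≥] (0 : ℝ), c'.toFun t = k (circ u e' t)) :
    gAngle c c' = angle e e' := by
  have hmono : 𝓝[>] (0 : ℝ) ≤ 𝓝[≥] 0 := nhdsWithin_mono _ Set.Ioi_subset_Ici_self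
  have ev : ∀ c : GeodesicFrom x, ∀ᶠ t in 𝓝[>] (0 : ℝ), 0 < t ∧ dist x (c.toFun t) = t := by
    intro c
    filter_upwards [Ioc_mem_nhdsGT c.length_pos] with t ht
    exact ⟨ht.1, dist_start c ht.1.le ht.2⟩
  have hev := ((ev c).and (hmono hc)).prod_mk ((ev c').and (hmono hc'))
  have h1 : Tendsto (Prod.fst : ℝ × ℝ → ℝ) (𝓝[>] 0 ×ˢ 𝓝[>] 0) (𝓝 0) :=
    tendsto_fst.mono_right nhdsWithin_le_nhds
  have h2 : Tendsto (Prod.snd : ℝ × ℝ → ℝ) (𝓝[>] 0 ×ˢ 𝓝[>] 0) (𝓝 0) :=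
    tendsto_snd.mono_right nhdsWithin_le_nhds
  let d : ℝ × ℝ → ℝ := fun p => angle (circ u e p.1) (circ u e' p.2)
  have hin := inner_circ hu hue hue'
  have hd : Tendsto d (𝓝[>] 0 ×ˢ 𝓝[>] 0) (𝓝 0) := by
    have hf : Continuous fun p : ℝ × ℝ => Real.arccos
        (Real.cos p.1 * Real.cos p.2 + Real.sin p.1 * Real.sin p.2 * ⟪e, e'⟫) := by fun_prop
    have hlim := (hf.tendsto (0, 0)).comp (h1.prodMk_nhds h2)
    simp only [Real.cos_zero, Real.sin_zero, mul_one, mul_zero, zero_mul, add_zero,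
      Real.arccos_one] at hlim
    refine hlim.congr fun p => ?_
    simp only [d, Function.comp]
    rw [angle_eq_arccos (norm_circ hu he hue _) (norm_circ hu he' hue' _), hin]
  have hlim := tendsto_comparison_cos (c := ⟪e, e'⟫) h1 h2 hd
    (hev.mono fun p hp => ⟨hp.1.1.1, hp.2.1.1⟩)
    (Eventually.of_forall fun p => by
      rw [← hin, inner_eq_cos_angle_of_norm_eq_one (norm_circ hu he hue _)
        (norm_circ hu he' hue' _)])
  have hlim2 := (Real.continuous_arccos.tendsto _).comp hlim
  rw [← angle_eq_arccos he he'] at hlim2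
  refine (hlim2.congr' ?_).limsup_eq
  filter_upwards [hev] with p hp
  obtain ⟨⟨⟨-, e1⟩, e2⟩, ⟨-, e3⟩, e4⟩ := hp
  have e5 : dist (c.toFun p.1) (c'.toFun p.2) = d p := by
    rw [e2, e4, hk.dist_eq (ne_zero_of_norm_one (norm_circ hu he hue _))
      (ne_zero_of_norm_one (norm_circ hu he' hue' _))]
  rw [Function.comp, compAngle, e1, e3, e5]

/-- Two great half circles from `k u` to an antipode agree if they agree initially. -/
theorem IsConeChart.circ_eq_circ {k₁ k₂ : E (n + 1) → B} (h₁ : X.IsConeChart k₁)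
    (h₂ : X.IsConeChart k₂) {u e₁ e₂ : E (n + 1)} (hu : ‖u‖ = 1) (he₁ : ‖e₁‖ = 1)
    (hue₁ : ⟪u, e₁⟫ = 0) (he₂ : ‖e₂‖ = 1) (hue₂ : ⟪u, e₂⟫ = 0) (hz : k₁ (-u) = k₂ (-u))
    (h : ∀ᶠ t in 𝓝[≥] (0 : ℝ), k₁ (circ u e₁ t) = k₂ (circ u e₂ t)) {t : ℝ}
    (ht : t ∈ Set.Icc 0 Real.pi) : k₁ (circ u e₁ t) = k₂ (circ u e₂ t) := by
  rcases ht.1.eq_or_lt with rfl | h0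
  · exact h.self_of_nhdsWithin Set.self_mem_Ici
  -- From time s > 0 on, only length π - s < π remains, where geodesics are unique.
  obtain ⟨s, hs, hs0, hst⟩ := ((h.filter_mono
    (nhdsWithin_mono _ Set.Ioi_subset_Ici_self)).and (Ioo_mem_nhdsGT h0)).exists
  have a1 : |s - Real.pi| = Real.pi - s := by
    rw [abs_sub_comm, abs_of_nonneg (by linarith [ht.2])]
  have a2 : |s - t| = t - s := by rw [abs_sub_comm, abs_of_nonneg (by linarith)]
  have a3 : |t - Real.pi| = Real.pi - t := by
    rw [abs_sub_comm, abs_of_nonneg (by linarith [ht.2])]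
  have hpi : Real.pi - s ≤ Real.pi := by linarith
  have hts : t - s ≤ Real.pi := by linarith [ht.2]
  have htp : Real.pi - t ≤ Real.pi := by linarith
  have d1 := h₁.dist_circ hu he₁ hue₁ (s := s) (t := Real.pi) (by rwa [a1])
  have d2 := h₁.dist_circ hu he₁ hue₁ (s := s) (t := t) (by rwa [a2])
  have d3 := h₁.dist_circ hu he₁ hue₁ (s := t) (t := Real.pi) (by rwa [a3])
  have d2' := h₂.dist_circ hu he₂ hue₂ (s := s) (t := t) (by rwa [a2])
  have d3' := h₂.dist_circ hu he₂ hue₂ (s := t) (t := Real.pi) (by rwa [a3])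
  rw [a1, circ_pi] at d1
  rw [a2] at d2
  rw [a3, circ_pi] at d3
  rw [a2, ← hs] at d2'
  rw [a3, circ_pi, ← hz] at d3'
  refine X.cat1.eq_of_between (p := k₁ (circ u e₁ s)) (q := k₁ (-u)) (by linarith) ?_ ?_ ?_
  · unfold Between
    linarith
  · unfold Between
    linarith
  · rw [d2, d2']

/-- The geodesics `r ξ` from `x` to its antipode `z` in all directions `ξ`. -/
structure IsRayFamily (X : SphericalBuilding n B) (u : E (n + 1)) (x z : B)
    (r : Directions x → ℝ → B) : Prop where
  exists_chart : ∀ ξ₁ ξ₂, ∃ k e₁ e₂, X.IsConeChart k ∧ k u = x ∧ k (-u) = z ∧ ‖e₁‖ = 1 ∧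
    ⟪u, e₁⟫ = 0 ∧ ‖e₂‖ = 1 ∧ ⟪u, e₂⟫ = 0 ∧ angle e₁ e₂ = dist ξ₁ ξ₂ ∧
    (∀ t ∈ Set.Icc 0 Real.pi, r ξ₁ t = k (circ u e₁ t)) ∧
    ∀ t ∈ Set.Icc 0 Real.pi, r ξ₂ t = k (circ u e₂ t)
  eventually_eq : ∀ c : GeodesicFrom x,
    ∀ᶠ t in 𝓝[≥] (0 : ℝ), r (SeparationQuotient.mk c) t = c.toFun t

/-- Moving the antipode of a common chart to z leaves the germ at x unchanged, and with it the
starts of both geodesics. -/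
theorem IsConeChart.exists_antipodal_common {k₀ : E (n + 1) → B} (hk₀ : X.IsConeChart k₀)
    {u : E (n + 1)} (hu : ‖u‖ = 1) {x z : B} (hkx : k₀ u = x) (hxz : dist x z = Real.pi)
    (c₁ c₂ : GeodesicFrom x) :
    ∃ k e₁ e₂, X.IsConeChart k ∧ k u = x ∧ k (-u) = z ∧ ‖e₁‖ = 1 ∧ ⟪u, e₁⟫ = 0 ∧ ‖e₂‖ = 1 ∧
      ⟪u, e₂⟫ = 0 ∧ (∀ᶠ t in 𝓝[≥] (0 : ℝ), c₁.toFun t = k (circ u e₁ t)) ∧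
      ∀ᶠ t in 𝓝[≥] (0 : ℝ), c₂.toFun t = k (circ u e₂ t) := by
  obtain ⟨k, e₁, e₂, hk, hku, he₁, hue₁, he₂, hue₂, H₁, H₂⟩ := hk₀.exists_common hu hkx c₁ c₂
  obtain ⟨k', h', hz, hev⟩ := hk.exists_antipodal (ne_zero_of_norm_one hu) (a := z)
    (by rwa [hku])
  refine ⟨k', e₁, e₂, h', by rw [hev.self_of_nhds, hku], hz, he₁, hue₁, he₂, hue₂, ?_, ?_⟩
  · filter_upwards [H₁, (tendsto_circ u e₁).eventually hev] with t h1 h2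
    rw [h1, h2]
  · filter_upwards [H₂, (tendsto_circ u e₂).eventually hev] with t h1 h2
    rw [h1, h2]

/-- Each direction gets a ray by choosing a representative and a chart. By `circ_eq_circ` the ray
does not depend on the chart, so any two rays can be read in a common one. -/
theorem IsConeChart.exists_isRayFamily {k₀ : E (n + 1) → B} (hk₀ : X.IsConeChart k₀)
    {u : E (n + 1)} (hu : ‖u‖ = 1) {x z : B} (hkx : k₀ u = x) (hxz : dist x z = Real.pi) :
    ∃ r, X.IsRayFamily u x z r := by
  choose c hc using fun ξ : Directions x => SeparationQuotient.surjective_mk ξ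
  choose k e _ hk _ hkz he hue _ _ hg _ using
    fun ξ => hk₀.exists_antipodal_common hu hkx hxz (c ξ) (c ξ)
  refine ⟨fun ξ t => k ξ (circ u (e ξ) t), fun ξ₁ ξ₂ => ?_, fun g => ?_⟩
  · obtain ⟨k', e₁, e₂, h', hku, hz, he₁, hue₁, he₂, hue₂, H₁, H₂⟩ :=
      hk₀.exists_antipodal_common hu hkx hxz (c ξ₁) (c ξ₂)
    refine ⟨k', e₁, e₂, h', hku, hz, he₁, hue₁, he₂, hue₂, ?_, fun t ht => ?_, fun t ht => ?_⟩
    · calc angle e₁ e₂ = dist (SeparationQuotient.mk (c ξ₁)) (SeparationQuotient.mk (c ξ₂)) :=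
          (h'.gAngle_eq hu he₁ hue₁ he₂ hue₂ H₁ H₂).symm
        _ = dist ξ₁ ξ₂ := by rw [hc, hc]
    · refine (hk ξ₁).circ_eq_circ h' hu (he ξ₁) (hue ξ₁) he₁ hue₁ ((hkz ξ₁).trans hz.symm) ?_ ht
      filter_upwards [hg ξ₁, H₁] with t h1 h2
      rw [← h1, h2]
    · refine (hk ξ₂).circ_eq_circ h' hu (he ξ₂) (hue ξ₂) he₂ hue₂ ((hkz ξ₂).trans hz.symm) ?_ ht
      filter_upwards [hg ξ₂, H₂] with t h1 h2
      rw [← h1, h2]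
  · obtain ⟨k', e₁, e₂, h', -, -, he₁, hue₁, he₂, hue₂, H₁, H₂⟩ :=
      hk₀.exists_antipodal_common hu hkx hxz g (c (SeparationQuotient.mk g))
    -- Geodesics with the same direction have equal initial vectors in a common chart, so they start
    -- alike.
    have h0 : angle e₁ e₂ = 0 := by
      rw [← h'.gAngle_eq hu he₁ hue₁ he₂ hue₂ H₁ H₂]
      exact Metric.inseparable_iff.1 (SeparationQuotient.mk_eq_mk.1 (hc _).symm)
    have h12 := eq_of_angle_eq_zero_of_norm_eq h0 (he₁.trans he₂.symm)
    filter_upwards [hg (SeparationQuotient.mk g), H₁, H₂] with t h1 h2 h3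
    rw [← h1, h2, h3, h12]

namespace IsRayFamily

variable {u : E (n + 1)} {x z : B} {r : Directions x → ℝ → B}

theorem dist_eq (hr : X.IsRayFamily u x z r) (hu : ‖u‖ = 1) (ξ : Directions x) {s t : ℝ}
    (hs : s ∈ Set.Icc 0 Real.pi) (ht : t ∈ Set.Icc 0 Real.pi) :
    dist (r ξ s) (r ξ t) = |s - t| := by
  obtain ⟨k, e, -, hk, -, -, he, hue, -, -, -, H, -⟩ := hr.exists_chart ξ ξ
  rw [H s hs, H t ht, hk.dist_circ hu he hue
    (abs_le.2 ⟨by linarith [hs.1, ht.2], by linarith [hs.2, ht.1]⟩)]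

theorem apply_zero (hr : X.IsRayFamily u x z r) (ξ : Directions x) : r ξ 0 = x := by
  obtain ⟨k, e, -, -, hkx, -, -, -, -, -, -, H, -⟩ := hr.exists_chart ξ ξ
  rw [H 0 ⟨le_rfl, Real.pi_pos.le⟩, circ_zero, hkx]

theorem apply_pi (hr : X.IsRayFamily u x z r) (ξ : Directions x) : r ξ Real.pi = z := by
  obtain ⟨k, e, -, -, -, hkz, -, -, -, -, -, H, -⟩ := hr.exists_chart ξ ξ
  rw [H _ ⟨Real.pi_pos.le, le_rfl⟩, circ_pi, hkz]

theorem dist_left (hr : X.IsRayFamily u x z r) (hu : ‖u‖ = 1) (ξ : Directions x) {t : ℝ}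
    (ht : t ∈ Set.Icc 0 Real.pi) : dist x (r ξ t) = t := by
  have := hr.dist_eq hu ξ ⟨le_rfl, Real.pi_pos.le⟩ ht
  rwa [hr.apply_zero, zero_sub, abs_neg, abs_of_nonneg ht.1] at this

theorem dist_right (hr : X.IsRayFamily u x z r) (hu : ‖u‖ = 1) (ξ : Directions x) {t : ℝ}
    (ht : t ∈ Set.Icc 0 Real.pi) : dist z (r ξ t) = Real.pi - t := by
  have := hr.dist_eq hu ξ ⟨Real.pi_pos.le, le_rfl⟩ ht
  rwa [hr.apply_pi, abs_of_nonneg (by linarith [ht.2])] at this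

theorem mk_eq (hr : X.IsRayFamily u x z r) (hu : ‖u‖ = 1) {ξ : Directions x}
    {c : GeodesicFrom x} (h : ∀ᶠ t in 𝓝[≥] (0 : ℝ), c.toFun t = r ξ t) :
    SeparationQuotient.mk c = ξ := by
  obtain ⟨c', rfl⟩ := SeparationQuotient.surjective_mk ξ
  obtain ⟨k, e, -, hk, -, -, he, hue, -, -, -, H, -⟩ :=
    hr.exists_chart (SeparationQuotient.mk c') (SeparationQuotient.mk c')
  have H' := eventually_of_Icc Real.pi_pos H
  refine SeparationQuotient.mk_eq_mk.2 (Metric.inseparable_iff.2 ?_)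
  show gAngle c c' = 0
  rw [hk.gAngle_eq hu he hue he hue (c := c) (c' := c'), angle_self (ne_zero_of_norm_one he)]
  · filter_upwards [h, H'] with t h1 h2
    rw [h1, h2]
  · filter_upwards [hr.eventually_eq c', H'] with t h1 h2
    rw [← h1, h2]

end IsRayFamily

end SphericalBuilding

/-! ### The suspension of a sphere of directions -/

theorem exists_orthogonal_isometry {n : ℕ} {u : E (n + 1)} (hu : ‖u‖ = 1) :
    ∃ J : E n →ₗᵢ[ℝ] E (n + 1), (∀ η, ⟪u, J η⟫ = 0) ∧ ∀ e, ⟪u, e⟫ = 0 → ∃ η, J η = e := by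
  have : Fact (Module.finrank ℝ (E (n + 1)) = n + 1) := ⟨by simp⟩
  let L := (OrthonormalBasis.fromOrthogonalSpanSingleton (𝕜 := ℝ) n (ne_zero_of_norm_one hu)).repr
  refine ⟨(Submodule.subtypeₗᵢ _).comp L.symm.toLinearIsometry, fun η => ?_, fun e he => ?_⟩
  · exact Submodule.mem_orthogonal_singleton_iff_inner_right.1 (L.symm η).2
  · refine ⟨L ⟨e, Submodule.mem_orthogonal_singleton_iff_inner_right.2 he⟩, ?_⟩
    simp

namespace SphericalBuilding

variable {n : ℕ} {B : Type*} [MetricSpace B] {X : SphericalBuilding n B}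

/-- The suspension of a map `φ` to the space of directions at `x`, with second pole `z`,
as a relation: the point `y` of the building corresponds to the vector `v`. -/
def SuspensionRel {x : B} (u : E (n + 1)) (z : B) (r : Directions x → ℝ → B)
    (φ : USphere n → Directions x) (J : E n →ₗᵢ[ℝ] E (n + 1)) (v : E (n + 1)) (y : B) : Prop :=
  (v = u ∧ y = x) ∨ (v = -u ∧ y = z) ∨
    ∃ η : USphere n, ∃ t ∈ Set.Ioo 0 Real.pi, v = circ u (J η) t ∧ y = r (φ η) t

section suspension

variable {u : E (n + 1)} {x z : B} {r : Directions x → ℝ → B} {φ : USphere n → Directions x}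
  {J : E n →ₗᵢ[ℝ] E (n + 1)}

/-- With `SuspensionRel.dist_eq` this makes the relation a function on unit vectors: points related
to the same vector have distance zero. -/
theorem SuspensionRel.exists_point (hu : ‖u‖ = 1) (hJ' : ∀ e, ⟪u, e⟫ = 0 → ∃ η, J η = e)
    {v : E (n + 1)} (hv : ‖v‖ = 1) : ∃ y, SuspensionRel u z r φ J v y := by
  rcases (angle_nonneg u v).eq_or_lt with h | h0
  · exact ⟨x, Or.inl ⟨(eq_of_angle_eq_zero_of_norm_eq h.symm (hu.trans hv.symm)).symm, rfl⟩⟩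
  rcases (angle_le_pi u v).eq_or_lt with h | hpi
  · refine ⟨z, Or.inr (Or.inl ⟨?_, rfl⟩)⟩
    refine (eq_of_angle_eq_zero_of_norm_eq ?_ (by rw [norm_neg, hu, hv])).symm
    rw [angle_neg_left, h, sub_self]
  · obtain ⟨e, he, hue, hve⟩ := exists_circ hu hv h0 hpi
    obtain ⟨η, rfl⟩ := hJ' e hue
    rw [J.norm_map] at he
    exact ⟨_, Or.inr (Or.inr ⟨toSphere η he, _, ⟨h0, hpi⟩, hve, rfl⟩)⟩

theorem SuspensionRel.dist_left (hr : X.IsRayFamily u x z r) (hu : ‖u‖ = 1)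
    (hJ : ∀ η, ⟪u, J η⟫ = 0) (hxz : dist x z = Real.pi) {v : E (n + 1)} {y : B}
    (h : SuspensionRel u z r φ J v y) : dist x y = angle u v := by
  have hu0 := ne_zero_of_norm_one hu
  rcases h with ⟨rfl, rfl⟩ | ⟨rfl, rfl⟩ | ⟨η, t, ht, rfl, rfl⟩
  · rw [dist_self, angle_self hu0]
  · rw [hxz, angle_self_neg_of_nonzero hu0]
  · have ht' := Set.Ioo_subset_Icc_self ht
    have habs : |0 - t| = t := by rw [zero_sub, abs_neg, abs_of_nonneg ht'.1]
    have := angle_circ hu (by rw [J.norm_map, norm_sphere]) (hJ η) (s := 0) (t := t)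
      (by rw [habs]; exact ht'.2)
    rw [circ_zero, habs] at this
    rw [hr.dist_left hu _ ht', this]

theorem SuspensionRel.dist_right (hr : X.IsRayFamily u x z r) (hu : ‖u‖ = 1)
    (hJ : ∀ η, ⟪u, J η⟫ = 0) (hxz : dist x z = Real.pi) {v : E (n + 1)} {y : B}
    (h : SuspensionRel u z r φ J v y) : dist z y = angle (-u) v := by
  rw [angle_neg_left, ← h.dist_left hr hu hJ hxz]
  rcases h with ⟨-, rfl⟩ | ⟨-, rfl⟩ | ⟨η, t, ht, -, rfl⟩
  · rw [dist_comm, hxz, dist_self, sub_zero]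
  · rw [dist_self, hxz, sub_self]
  · have ht' := Set.Ioo_subset_Icc_self ht
    rw [hr.dist_left hu _ ht', hr.dist_right hu _ ht']

/-- Two rays are half circles in one chart, and by the law of cosines the distance of their points
depends only on the two times and the angle of the rays, which φ preserves. -/
theorem SuspensionRel.dist_eq (hr : X.IsRayFamily u x z r) (hu : ‖u‖ = 1)
    (hJ : ∀ η, ⟪u, J η⟫ = 0) (hxz : dist x z = Real.pi) (hφ : IsSphereEmbedding φ)
    {v v' : E (n + 1)} {y y' : B} (h : SuspensionRel u z r φ J v y)
    (h' : SuspensionRel u z r φ J v' y') : dist y y' = angle v v' := by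
  rcases id h with ⟨rfl, rfl⟩ | ⟨rfl, rfl⟩ | ⟨η, t, ht, rfl, rfl⟩
  · exact h'.dist_left hr hu hJ hxz
  · exact h'.dist_right hr hu hJ hxz
  rcases id h' with ⟨rfl, rfl⟩ | ⟨rfl, rfl⟩ | ⟨η', t', ht', rfl, rfl⟩
  · rw [dist_comm, angle_comm]
    exact h.dist_left hr hu hJ hxz
  · rw [dist_comm, angle_comm]
    exact h.dist_right hr hu hJ hxz
  obtain ⟨k, e₁, e₂, hk, -, -, he₁, hue₁, he₂, hue₂, hang, H₁, H₂⟩ :=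
    hr.exists_chart (φ η) (φ η')
  have nJ : ∀ η : USphere n, ‖J η‖ = 1 := fun η => by rw [J.norm_map, norm_sphere]
  have c₁ := norm_circ hu he₁ hue₁ t
  have c₂ := norm_circ hu he₂ hue₂ t'
  have hin : ⟪e₁, e₂⟫ = ⟪J η, J η'⟫ := by
    rw [J.inner_map_map]
    exact inner_eq_of_angle_eq he₁ he₂ (norm_sphere _) (norm_sphere _) (hang.trans (hφ η η'))
  rw [H₁ t (Set.Ioo_subset_Icc_self ht), H₂ t' (Set.Ioo_subset_Icc_self ht'),
    hk.dist_eq (ne_zero_of_norm_one c₁) (ne_zero_of_norm_one c₂), angle_eq_arccos c₁ c₂,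
    angle_eq_arccos (norm_circ hu (nJ η) (hJ η) t) (norm_circ hu (nJ η') (hJ η') t'),
    inner_circ hu hue₁ hue₂, inner_circ hu (hJ η) (hJ η'), hin]

end suspension

/-- An apartment through `x` and its antipode `z` in prescribed directions at `x`. -/
theorem exists_apartment_of_directions {u : E (n + 1)} {x z : B} (hu : ‖u‖ = 1)
    {r : Directions x → ℝ → B} (hr : X.IsRayFamily u x z r) (hxz : dist x z = Real.pi)
    {φ : USphere n → Directions x} (hφ : IsSphereEmbedding φ) :
    ∃ A, X.IsApartment A ∧ directionsOf A x = Set.range φ ∧ x ∈ A ∧ z ∈ A ∧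
      ∀ η, ∀ t ∈ Set.Ioo 0 Real.pi, r (φ η) t ∈ A := by
  obtain ⟨J, hJ, hJ'⟩ := exists_orthogonal_isometry hu
  choose F hF using fun v : USphere (n + 1) =>
    SuspensionRel.exists_point (z := z) (r := r) (φ := φ) hu hJ' (norm_sphere v)
  have hmem : ∀ {v : E (n + 1)} {y : B}, ‖v‖ = 1 → SuspensionRel u z r φ J v y →
      y ∈ Set.range F := by
    intro v y hv h
    refine ⟨toSphere v hv, dist_eq_zero.1 ?_⟩
    rw [(hF (toSphere v hv)).dist_eq hr hu hJ hxz hφ h]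
    exact angle_self (ne_zero_of_norm_one hv)
  have hiso : IsSphereEmbedding F := fun v w => (hF v).dist_eq hr hu hJ hxz hφ (hF w)
  have hx : x ∈ Set.range F := hmem hu (Or.inl ⟨rfl, rfl⟩)
  have hz : z ∈ Set.range F := hmem (by rw [norm_neg, hu]) (Or.inr (Or.inl ⟨rfl, rfl⟩))
  have hray : ∀ η, ∀ t ∈ Set.Ioo 0 Real.pi, r (φ η) t ∈ Set.range F := fun η t ht =>
    hmem (norm_circ hu (by rw [J.norm_map, norm_sphere]) (hJ η) t)
      (Or.inr (Or.inr ⟨η, t, ht, rfl, rfl⟩))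
  refine ⟨Set.range F, ?_, ?_, hx, hz, hray⟩
  -- The containment result, now for the suspension: it lies in the image of ι. Then ι⁻¹ ∘ F is an
  -- isometric self-map of the sphere, hence onto, and the two images coincide.
  · obtain ⟨k, ⟨ι, hι, hk⟩, hsup⟩ :=
      X.exists_isConeChart_superset (hiso.isConvex X.cat1) hiso.isSpherical ⟨x, hx⟩
    have hpre : ∀ v, ∃ w, ι w = F v := by
      intro v
      obtain ⟨y, hy, hky⟩ := hsup (F v) ⟨v, rfl⟩
      refine ⟨toSphere _ (norm_unit hy), ?_⟩
      rw [← hk _ (norm_unit hy) ‖y‖ (norm_pos_iff.2 hy), norm_smul_unit hy, hky]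
    choose h hh using hpre
    have hsurj : Function.Surjective h :=
      surjective_of_angDist fun v w => by rw [← X.isometric ι hι, hh, hh, hiso]
    refine ⟨ι, hι, Set.Subset.antisymm ?_ ?_⟩
    · rintro _ ⟨w, rfl⟩
      obtain ⟨v, rfl⟩ := hsurj w
      exact ⟨v, (hh v).symm⟩
    · rintro _ ⟨v, rfl⟩
      exact ⟨h v, hh v⟩
  · have hpi : (1 : ℝ) < Real.pi := by linarith [Real.pi_gt_three]
    ext ξ
    constructor
    · rintro ⟨c, hc, rfl⟩
      -- Truncating below π keeps the end away from both poles. It therefore lies on a single ray,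
      -- which contains the whole truncated geodesic by uniqueness.
      have h0 : 0 < min c.length 1 := lt_min c.length_pos one_pos
      have hl : min c.length 1 ≤ c.length := min_le_left _ _
      have h1 : min c.length 1 < Real.pi := (min_le_right _ _).trans_lt hpi
      obtain ⟨v, hv⟩ := hc _ ⟨h0.le, hl⟩
      have hd := dist_start c h0.le hl
      rcases hF v with ⟨-, h⟩ | ⟨-, h⟩ | ⟨η, t, ht, -, h⟩
      · rw [← hv, h, dist_self] at hd
        exact absurd hd h0.ne
      · rw [← hv, h, hxz] at hd
        exact absurd hd h1.ne'
      · rw [hv] at h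
        have ht' := Set.Ioo_subset_Icc_self ht
        have htl : t = min c.length 1 := by rw [← hd, h, hr.dist_left hu _ ht']
        refine ⟨η, (hr.mk_eq hu (eventually_of_Icc h0 fun s hs => ?_)).symm⟩
        have hs' : s ∈ Set.Icc 0 Real.pi := ⟨hs.1, hs.2.trans h1.le⟩
        have d1 := dist_start c hs.1 (hs.2.trans hl)
        have d2 := c.isometric s ⟨hs.1, hs.2.trans hl⟩ _ ⟨h0.le, hl⟩
        have d3 := hr.dist_left hu (φ η) hs'
        have d4 := hr.dist_eq hu (φ η) hs' ht'
        rw [← h, htl] at d4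
        rw [abs_sub_comm, abs_of_nonneg (by linarith [hs.2])] at d2 d4
        refine X.cat1.eq_of_between (p := x) (q := c.toFun (min c.length 1)) (by rwa [hd])
          ?_ ?_ (d1.trans d3.symm)
        · unfold Between
          linarith
        · unfold Between
          linarith
    · rintro ⟨η, rfl⟩
      have hIcc : Set.Icc (0 : ℝ) 1 ⊆ Set.Icc 0 Real.pi := Set.Icc_subset_Icc_right hpi.le
      refine ⟨⟨1, one_pos, r (φ η), hr.apply_zero _,
        fun s hs t ht => hr.dist_eq hu _ (hIcc hs) (hIcc ht)⟩, fun t ht => ?_,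
        hr.mk_eq hu (Eventually.of_forall fun _ => rfl)⟩
      rcases ht.1.eq_or_lt with rfl | h0
      · have h : r (φ η) 0 ∈ Set.range F := by
          rw [hr.apply_zero]
          exact hx
        exact h
      · exact hray η t ⟨h0, ht.2.trans_lt hpi⟩

end SphericalBuilding

end SphBuild

end

/-! ### The prescribed apartment contains C -/

open SphBuild InnerProductGeometry in
theorem corollary3p4 {n : ℕ} {B : Type*} [MetricSpace B] [CompleteSpace B]
    (X : SphBuild.SphericalBuilding n B) (C : Set B) (hclosed : IsClosed C)
    (hconv : SphBuild.IsConvex C) (hsph : SphBuild.IsSpherical C) (x : B) (hx : x ∈ C)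
    (Ax : Set (SphBuild.Directions x)) (hAx : SphBuild.IsRoundSphere n Ax)
    (hCA : SphBuild.directionsOf C x ⊆ Ax) :
    ∃ A : Set B, X.IsApartment A ∧ C ⊆ A ∧ SphBuild.directionsOf A x = Ax := by
  obtain ⟨φ, hφ, rfl⟩ := hAx
  obtain ⟨k, hk, hC⟩ := X.exists_isConeChart_superset hconv hsph ⟨x, hx⟩
  obtain ⟨u', hu', hku'⟩ := hC x hx
  obtain ⟨u, hu, hku⟩ : ∃ u, ‖u‖ = 1 ∧ k u = x :=
    ⟨_, SphericalBuilding.norm_unit hu', by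
      rw [hk.apply_smul hu' (inv_pos.2 (norm_pos_iff.2 hu')), hku']⟩
  have hu0 := ne_zero_of_norm_one hu
  have hxz : dist x (k (-u)) = Real.pi := by
    rw [← hku, hk.dist_eq hu0 (neg_ne_zero.2 hu0), angle_self_neg_of_nonzero hu0]
  obtain ⟨r, hr⟩ := hk.exists_isRayFamily hu hku hxz
  obtain ⟨A, hA, hdir, hxA, hzA, hray⟩ :=
    SphericalBuilding.exists_apartment_of_directions hu hr hxz hφ
  refine ⟨A, hA, fun c hc => ?_, hdir⟩
  obtain ⟨y', hy', rfl⟩ := hC c hc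
  have hky := hk.apply_smul hy' (inv_pos.2 (norm_pos_iff.2 hy'))
  have hy := SphericalBuilding.norm_unit hy'
  rw [← hky] at hc ⊢
  set y := ‖y'‖⁻¹ • y'
  have hy0 := ne_zero_of_norm_one hy
  rcases (angle_nonneg u y).eq_or_lt with h | h0
  · rwa [← eq_of_angle_eq_zero_of_norm_eq h.symm (hu.trans hy.symm), hku]
  rcases (angle_le_pi u y).eq_or_lt with h | hpi
  · rwa [← hk.map_neg_eq hu0 hy0 (by rw [hk.dist_eq hu0 hy0, h])]
  obtain ⟨e, he, hue, hye⟩ := exists_circ hu hy h0 hpi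
  set θ := angle u y
  have hθ : ∀ t ∈ Set.Icc 0 θ, ∀ s ∈ Set.Icc 0 θ,
      dist (k (circ u e t)) (k (circ u e s)) = |t - s| := fun t ht s hs =>
    hk.dist_circ hu he hue (abs_le.2 ⟨by linarith [ht.1, hs.2], by linarith [ht.2, hs.1]⟩)
  -- The segment from x to the given point runs in C, so its direction belongs to A_x.
  let g : GeodesicFrom x := ⟨θ, h0, fun t => k (circ u e t), by rw [circ_zero, hku], hθ⟩
  have hgC : ∀ t ∈ Set.Icc 0 g.length, g.toFun t ∈ C := by
    intro t ht
    have d1 := dist_start g ht.1 ht.2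
    have d2 := dist_start g h0.le le_rfl
    have d3 := hθ t ht θ ⟨h0.le, le_rfl⟩
    rw [abs_sub_comm, abs_of_nonneg (sub_nonneg.2 ht.2)] at d3
    change dist x (k (circ u e t)) = t at d1
    change dist x (k (circ u e θ)) = θ at d2
    rw [← hye] at d2 d3
    refine hconv x hx (k y) hc (by rwa [d2]) _ ?_
    change dist x (k (circ u e t)) + dist (k (circ u e t)) (k y) = dist x (k y)
    linarith
  obtain ⟨η, hη⟩ := hCA ⟨g, hgC, rfl⟩
  obtain ⟨k', e', -, h', hku', hkz', he', hue', -, -, -, H, -⟩ := hr.exists_chart (φ η) (φ η)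
  have hθ' : θ ∈ Set.Icc 0 Real.pi := ⟨h0.le, hpi.le⟩
  -- The half circle of k through the point and the ray in its direction start alike and both end at
  -- z, so they coincide.
  have key : k (circ u e θ) = k' (circ u e' θ) := by
    refine hk.circ_eq_circ h' hu he hue he' hue' hkz'.symm ?_ hθ'
    filter_upwards [hr.eventually_eq g, SphericalBuilding.eventually_of_Icc Real.pi_pos H]
      with t h1 h2
    rw [← h2, hη, h1]
  rw [hye, key, ← H θ hθ']
  exact hray η θ ⟨h0, hpi⟩
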